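/- Let $X$ be a random vector in $\mathbb{R}^n$ and, for every $t>0$, let $Z_t\sim\mathcal N(0,tI_n)$ be independent of $X$. Write $I(\cdot\,;\cdot)$ for mutual information in nats, $J(U)=\mathbb{E}\,\|\nabla\log p_U(U)\|^2$ for the Fisher information of a random vector $U$ with continuously differentiable density $p_U$, and $\operatorname{Cov}(U)$ for the covariance matrix. (a) Suppose $\mathbb{E}\|X\|^2<\infty$, let $Y_t=X+Z_t$ and $\mathrm{mmse}(t)=\mathbb{E}\,\|X-\mathbb{E}[X\mid Y_t]\|^2$. Then for every $t>0$ the vector $Y_t$ has a positive continuously differentiable density, $J(Y_t)<\infty$, and $$0\le \frac nt-J(Y_t)=\frac{\mathrm{mmse}(t)}{t^2}\le\frac{\operatorname{tr}\operatorname{Cov}(X)}{t^2}.$$ Moreover, for every $T>0$, $I(X;Y_T)$ is finite, $t\mapsto \frac nt-J(Y_t)$ is integrable on $(T,\infty)$, and $$I(X;Y_T)=\frac12\int_T^\infty\Bigl(\frac nt-J(Y_t)\Bigr)\,dt .$$ (b) Let $f:\mathbb{R}^n\to\mathbb{R}^n$ be measurable, $W=f(X)$ and $Y_t=W+Z_t$.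 Then $I(X;Y_t)=I(W;Y_t)$ for every $t>0$. If moreover $\mathbb{E}\|W\|^2<\infty$ (no moment of $X$ is required), then for every $t>0$ the vector $Y_t$ has a positive continuously differentiable density, $J(Y_t)<\infty$, and $$0\le \frac nt-J(Y_t)=\frac{\mathbb{E}\,\|W-\mathbb{E}[W\mid Y_t]\|^2}{t^2}\le\frac{\operatorname{tr}\operatorname{Cov}(W)}{t^2},$$ and for every $T>0$, $I(X;Y_T)$ is finite, $t\mapsto \frac nt-J(Y_t)$ is integrable on $(T,\infty)$, and $$I(X;Y_T)=\frac12\int_T^\infty\Bigl(\frac nt-J(Y_t)\Bigr)\,dt .$$ -/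

import Mathlib

open MeasureTheory ProbabilityTheory InformationTheory Set

noncomputable section

/-- Mutual information `I(U;V)` in nats: the Kullback–Leibler divergence of the joint law of
`(U, V)` from the product of the marginal laws. -/
def mutualInfo {Ω α β : Type*} [MeasurableSpace Ω] [MeasurableSpace α] [MeasurableSpace β]
    (U : Ω → α) (V : Ω → β) (μ : Measure Ω) : ENNReal :=
  klDiv (μ.map (fun ω => (U ω, V ω))) ((μ.map U).prod (μ.map V))

/-- `p` is a continuously differentiable probability density of the law `ν` with respect to
Lebesgue measure. Such a `p` is unique, since two continuous densities agree everywhere. -/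
structure IsC1Density {n : ℕ} (ν : Measure (EuclideanSpace ℝ (Fin n)))
    (p : EuclideanSpace ℝ (Fin n) → ℝ) : Prop where
  contDiff : ContDiff ℝ 1 p
  nonneg : ∀ y, 0 ≤ p y
  eq_withDensity : ν = volume.withDensity (fun y => ENNReal.ofReal (p y))

open Classical in
/-- The continuously differentiable density of `ν` (and `0` if there is none). -/
def density {n : ℕ} (ν : Measure (EuclideanSpace ℝ (Fin n))) : EuclideanSpace ℝ (Fin n) → ℝ :=
  if h : ∃ p, IsC1Density ν p then h.choose else 0

/-- The score function `∇ log p` of a law with density `p`. -/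
def score {n : ℕ} (ν : Measure (EuclideanSpace ℝ (Fin n))) (y : EuclideanSpace ℝ (Fin n)) :
    EuclideanSpace ℝ (Fin n) :=
  gradient (fun z => Real.log (density ν z)) y

/-- The scalar Fisher information `J(U) = 𝔼 ‖∇ log p_U(U)‖²` of the random vector `U`. -/
def fisherInfo {Ω : Type*} [MeasurableSpace Ω] {n : ℕ}
    (U : Ω → EuclideanSpace ℝ (Fin n)) (μ : Measure Ω) : ℝ :=
  ∫ y, ‖score (μ.map U) y‖ ^ 2 ∂(μ.map U)

/-- `𝔼 ‖U - 𝔼[U | V]‖²`, the minimum mean-square error of estimating `U` from `V`. -/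
def mmse {Ω : Type*} [MeasurableSpace Ω] {n : ℕ}
    (U V : Ω → EuclideanSpace ℝ (Fin n)) (μ : Measure Ω) : ℝ :=
  ∫ ω, ‖U ω - (μ[U | MeasurableSpace.comap V inferInstance]) ω‖ ^ 2 ∂μ

/-- The covariance matrix of a random vector. -/
def covMat {Ω : Type*} [MeasurableSpace Ω] {n : ℕ}
    (U : Ω → EuclideanSpace ℝ (Fin n)) (μ : Measure Ω) : Matrix (Fin n) (Fin n) ℝ :=
  Matrix.of fun i j => covariance (fun ω => U ω i) (fun ω => U ω j) μ

/-- The law of `U` has an everywhere positive `C¹` density, so that its score is defined at every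
point, and the score is square integrable: `J(U)` is well defined and finite. -/
def HasFiniteFisherInfo {Ω : Type*} [MeasurableSpace Ω] {n : ℕ}
    (U : Ω → EuclideanSpace ℝ (Fin n)) (μ : Measure Ω) : Prop :=
  IsC1Density (μ.map U) (density (μ.map U)) ∧ (∀ y, 0 < density (μ.map U) y) ∧
    Integrable (fun y => ‖score (μ.map U) y‖ ^ 2) (μ.map U)

end

/-!
The density of `Y_t = W + Z_t` is the convolution `p_t` of the law of `W` with the heat kernel, so
it is smooth and positive. Writing the score `∇ log p_t` as a ratio of integrals of the kernel shows
`𝔼[Z_t | Y_t] = -t ∇ log p_t(Y_t)` without any moment of `W`, and conditional Pythagoras turns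
`𝔼 ‖Z_t‖² = n t` into `n / t - J(Y_t) = 𝔼 ‖Z_t - 𝔼[Z_t | Y_t]‖² / t²`. Estimating the noise and
estimating the input from their sum are the same problem, which gives the minimum mean-square error.

The mutual information is `h(p_t) - h(Z_t)`, where `h` is the differential entropy. The heat
equation gives de Bruijn's identity `∂ₜ h(p_t) = J(Y_t) / 2`, hence `∂ₜ I = -(n / t - J(Y_t)) / 2`;
since this derivative has a sign and `0 ≤ I ≤ tr Cov(W) / t` tends to `0`, integrating over
`(T, ∞)` yields both the integrability and the formula. Finally, the likelihood ratio of
`(X, Y_t)` with respect to the product of its marginals only depends on `(f(X), Y_t)`, so passing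
from `X` to `f(X)` does not change the divergence.
-/

noncomputable section HeatKernel

variable {E : Type*} [NormedAddCommGroup E] [InnerProductSpace ℝ E]

/-- The heat kernel on `E`, normalised so that it solves `∂ₜ g = Δ g / 2`: for `0 < t` it is the
density of the centred Gaussian law with covariance `t • 1`. -/
def heatKernel (t : ℝ) (z : E) : ℝ :=
  (2 * Real.pi * t) ^ (-(Module.finrank ℝ E : ℝ) / 2) * Real.exp (-‖z‖ ^ 2 / (2 * t))

/-- The spatial gradient of `heatKernel`. -/
def heatKernelGradient (t : ℝ) (z : E) : E :=
  -(heatKernel t z / t) • z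

/-- The time derivative of `heatKernel`. -/
def heatKernelDeriv (t : ℝ) (z : E) : ℝ :=
  heatKernel t z * (‖z‖ ^ 2 / (2 * t ^ 2) - Module.finrank ℝ E / (2 * t))

variable {t : ℝ}

lemma heatKernel_pos (ht : 0 < t) (z : E) : 0 < heatKernel t z := by
  unfold heatKernel
  positivity

@[fun_prop]
lemma continuous_heatKernel (t : ℝ) : Continuous (heatKernel t : E → ℝ) := by
  unfold heatKernel
  fun_prop

@[fun_prop]
lemma continuous_heatKernelGradient (t : ℝ) : Continuous (heatKernelGradient t : E → E) := by
  unfold heatKernelGradient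
  fun_prop

@[fun_prop]
lemma continuous_heatKernelDeriv (t : ℝ) : Continuous (heatKernelDeriv t : E → ℝ) := by
  unfold heatKernelDeriv
  fun_prop

lemma heatKernel_neg (t : ℝ) (z : E) : heatKernel t (-z) = heatKernel t z := by
  simp [heatKernel]

lemma heatKernel_le (ht : 0 < t) (z : E) :
    heatKernel t z ≤ (2 * Real.pi * t) ^ (-(Module.finrank ℝ E : ℝ) / 2) := by
  refine mul_le_of_le_one_right (by positivity) (Real.exp_le_one_iff.2 ?_)
  exact div_nonpos_of_nonpos_of_nonneg (by simp) (by positivity)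

lemma log_heatKernel (ht : 0 < t) (z : E) :
    Real.log (heatKernel t z) =
      -(Module.finrank ℝ E / 2 * Real.log (2 * Real.pi * t)) - ‖z‖ ^ 2 / (2 * t) := by
  unfold heatKernel
  rw [Real.log_mul (by positivity) (by positivity), Real.log_exp, Real.log_rpow (by positivity)]
  ring

lemma one_add_sq_mul_exp_neg_sq_div_le {b : ℝ} (hb : 0 < b) (r : ℝ) :
    (1 + r ^ 2) * Real.exp (-r ^ 2 / b) ≤ 1 + b := by
  rw [neg_div, Real.exp_neg, ← div_eq_mul_inv, div_le_iff₀ (Real.exp_pos _)]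
  calc 1 + r ^ 2 ≤ (1 + b) * (r ^ 2 / b + 1) := by
        have : (1 + b) * (r ^ 2 / b + 1) = 1 + r ^ 2 + r ^ 2 / b + b := by field_simp; ring
        rw [this]
        linarith [show 0 ≤ r ^ 2 / b by positivity]
    _ ≤ (1 + b) * Real.exp (r ^ 2 / b) := by
        gcongr
        exact Real.add_one_le_exp _

/-- Doubling the variance absorbs quadratic weights, locally uniformly in time. -/
lemma exists_one_add_norm_sq_mul_heatKernel_le {a b : ℝ} (ha : 0 < a) (hab : a ≤ b) :
    ∃ C : ℝ, 0 ≤ C ∧ ∀ t ∈ Icc a b, ∀ z : E,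
      (1 + ‖z‖ ^ 2) * heatKernel t z ≤ C * heatKernel (2 * b) z := by
  have hb : 0 < b := ha.trans_le hab
  set k : ℝ := -(Module.finrank ℝ E : ℝ) / 2 with hk
  have hk_nonpos : k ≤ 0 := div_nonpos_of_nonpos_of_nonneg (by simp) (by positivity)
  have : 0 < (2 * Real.pi * (2 * b)) ^ k := by positivity
  refine ⟨(2 * Real.pi * a) ^ k / (2 * Real.pi * (2 * b)) ^ k * (1 + 4 * b), by positivity,
    fun t ⟨hat, htb⟩ z => ?_⟩
  have ht : 0 < t := ha.trans_le hat
  have hpow : (2 * Real.pi * t) ^ k ≤ (2 * Real.pi * a) ^ k :=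
    Real.rpow_le_rpow_of_nonpos (by positivity) (by gcongr) hk_nonpos
  have hexp : Real.exp (-‖z‖ ^ 2 / (2 * t)) ≤
      Real.exp (-‖z‖ ^ 2 / (4 * b)) * Real.exp (-‖z‖ ^ 2 / (2 * (2 * b))) := by
    have hle : ‖z‖ ^ 2 / (2 * b) ≤ ‖z‖ ^ 2 / (2 * t) := by gcongr
    have hsum : -‖z‖ ^ 2 / (4 * b) + -‖z‖ ^ 2 / (2 * (2 * b)) = -(‖z‖ ^ 2 / (2 * b)) := by
      field_simp
      ring
    rw [← Real.exp_add, Real.exp_le_exp, hsum, neg_div]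
    exact neg_le_neg hle
  calc (1 + ‖z‖ ^ 2) * heatKernel t z
      ≤ (1 + ‖z‖ ^ 2) * ((2 * Real.pi * a) ^ k *
        (Real.exp (-‖z‖ ^ 2 / (4 * b)) * Real.exp (-‖z‖ ^ 2 / (2 * (2 * b))))) := by
        rw [heatKernel]
        gcongr
    _ = (2 * Real.pi * a) ^ k * ((1 + ‖z‖ ^ 2) * Real.exp (-‖z‖ ^ 2 / (4 * b))) *
        Real.exp (-‖z‖ ^ 2 / (2 * (2 * b))) := by ring
    _ ≤ (2 * Real.pi * a) ^ k * (1 + 4 * b) * Real.exp (-‖z‖ ^ 2 / (2 * (2 * b))) := by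
        gcongr
        exact one_add_sq_mul_exp_neg_sq_div_le (by positivity) _
    _ = _ := by
        rw [heatKernel, ← hk]
        field_simp

lemma norm_heatKernelGradient_le (ht : 0 < t) (z : E) :
    ‖heatKernelGradient t z‖ ≤ 1 / t * ((1 + ‖z‖ ^ 2) * heatKernel t z) := by
  have hg := heatKernel_pos ht z
  have hz : ‖z‖ ≤ 1 + ‖z‖ ^ 2 := by nlinarith [sq_nonneg (‖z‖ - 1)]
  rw [heatKernelGradient, norm_smul, norm_neg, Real.norm_of_nonneg (by positivity)]
  calc heatKernel t z / t * ‖z‖ ≤ heatKernel t z / t * (1 + ‖z‖ ^ 2) := by gcongr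
    _ = _ := by ring

lemma abs_heatKernelDeriv_le (ht : 0 < t) (z : E) :
    |heatKernelDeriv t z| ≤
      (1 / (2 * t ^ 2) + Module.finrank ℝ E / (2 * t)) * ((1 + ‖z‖ ^ 2) * heatKernel t z) := by
  have hg := heatKernel_pos ht z
  rw [heatKernelDeriv, abs_mul, abs_of_pos hg]
  calc heatKernel t z * |‖z‖ ^ 2 / (2 * t ^ 2) - Module.finrank ℝ E / (2 * t)|
      ≤ heatKernel t z * (‖z‖ ^ 2 / (2 * t ^ 2) + Module.finrank ℝ E / (2 * t)) := by
        gcongr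
        refine (abs_sub _ _).trans_eq ?_
        rw [abs_of_nonneg (by positivity), abs_of_nonneg (by positivity)]
    _ ≤ heatKernel t z * ((1 / (2 * t ^ 2) + Module.finrank ℝ E / (2 * t)) * (1 + ‖z‖ ^ 2)) := by
        gcongr
        have : (1 / (2 * t ^ 2) + Module.finrank ℝ E / (2 * t)) * (1 + ‖z‖ ^ 2) =
          ‖z‖ ^ 2 / (2 * t ^ 2) + Module.finrank ℝ E / (2 * t) + 1 / (2 * t ^ 2) +
            Module.finrank ℝ E / (2 * t) * ‖z‖ ^ 2 := by ring
        rw [this, add_assoc (_ + _)]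
        exact le_add_of_nonneg_right (by positivity)
    _ = _ := by ring

lemma exists_abs_heatKernelDeriv_le {a b : ℝ} (ha : 0 < a) (hab : a ≤ b) :
    ∃ C : ℝ, ∀ t ∈ Icc a b, ∀ z : E, |heatKernelDeriv t z| ≤ C * heatKernel (2 * b) z := by
  obtain ⟨C, -, hle⟩ := exists_one_add_norm_sq_mul_heatKernel_le (E := E) ha hab
  refine ⟨(1 / (2 * a ^ 2) + Module.finrank ℝ E / (2 * a)) * C, fun t ht z => ?_⟩
  have hta : 0 < t := ha.trans_le ht.1
  rw [mul_assoc]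
  refine (abs_heatKernelDeriv_le hta z).trans (mul_le_mul ?_ (hle t ht z) ?_ (by positivity))
  · gcongr
    exacts [ht.1, ht.1]
  · exact mul_nonneg (by positivity) (heatKernel_pos hta z).le

lemma exists_norm_heatKernelGradient_le (ht : 0 < t) :
    ∃ C : ℝ, ∀ z : E, ‖heatKernelGradient t z‖ ≤ C := by
  obtain ⟨C, hC, hle⟩ := exists_one_add_norm_sq_mul_heatKernel_le (E := E) ht le_rfl
  refine ⟨1 / t * (C * (2 * Real.pi * (2 * t)) ^ (-(Module.finrank ℝ E : ℝ) / 2)), fun z => ?_⟩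
  refine (norm_heatKernelGradient_le ht z).trans (mul_le_mul_of_nonneg_left ?_ (by positivity))
  exact (hle t ⟨le_rfl, le_rfl⟩ z).trans
    (mul_le_mul_of_nonneg_left (heatKernel_le (by positivity) z) hC)

lemma hasGradientAt_heatKernel [CompleteSpace E] (ht : 0 < t) (z : E) :
    HasGradientAt (heatKernel t) (heatKernelGradient t z) z := by
  have hsq : HasFDerivAt (fun z : E => ‖z‖ ^ 2) (2 • innerSL ℝ z) z :=
    (hasStrictFDerivAt_norm_sq z).hasFDerivAt
  have hexp := ((hsq.const_mul (-1 / (2 * t))).exp).const_mul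
    ((2 * Real.pi * t) ^ (-(Module.finrank ℝ E : ℝ) / 2))
  have hrw : (heatKernel t : E → ℝ) = fun z =>
      (2 * Real.pi * t) ^ (-(Module.finrank ℝ E : ℝ) / 2) *
        Real.exp (-1 / (2 * t) * ‖z‖ ^ 2) := by
    ext z
    rw [heatKernel]
    ring_nf
  rw [hasGradientAt_iff_hasFDerivAt, hrw]
  refine hexp.congr_fderiv ?_
  ext v
  simp only [smul_apply, coe_innerSL_apply, nsmul_eq_mul, Nat.cast_ofNat, smul_eq_mul,
    heatKernelGradient, hrw, neg_smul, map_neg, map_smul, neg_apply,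
    InnerProductSpace.toDual_apply_apply]
  field_simp

lemma fderiv_heatKernel_mul_inner [CompleteSpace E] (ht : 0 < t) (v z : E) :
    fderiv ℝ (fun z => heatKernel t z * inner ℝ v z) z v =
      heatKernel t z * (‖v‖ ^ 2 - inner ℝ v z ^ 2 / t) := by
  have hderiv : HasFDerivAt (fun z => heatKernel t z * inner ℝ v z) _ z :=
    (hasGradientAt_heatKernel ht z).hasFDerivAt.mul (innerSL ℝ v).hasFDerivAt
  rw [hderiv.fderiv]
  simp only [real_inner_comm z v, heatKernelGradient, neg_smul, map_neg, map_smul, smul_neg,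
    add_apply, smul_apply, coe_innerSL_apply, inner_self_eq_norm_sq_to_K, Real.ringHom_apply,
    smul_eq_mul, neg_apply, InnerProductSpace.toDual_apply_apply]
  ring

lemma hasDerivAt_heatKernel (ht : 0 < t) (z : E) :
    HasDerivAt (fun s => heatKernel s z) (heatKernelDeriv t z) t := by
  have hlin : HasDerivAt (fun s : ℝ => 2 * Real.pi * s) (2 * Real.pi) t := by
    simpa using (hasDerivAt_id t).const_mul (2 * Real.pi)
  have hpow := hlin.rpow_const (p := -(Module.finrank ℝ E : ℝ) / 2) (Or.inl (by positivity))
  have hexponent : HasDerivAt (fun s : ℝ => -‖z‖ ^ 2 / (2 * s)) (‖z‖ ^ 2 / (2 * t ^ 2)) t := by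
    have := (((hasDerivAt_id t).const_mul (2 : ℝ)).fun_inv (by positivity)).const_mul (-‖z‖ ^ 2)
    simp only [id] at this
    refine this.congr_deriv ?_
    field_simp
  refine (hpow.mul hexponent.exp).congr_deriv ?_
  unfold heatKernelDeriv heatKernel
  rw [Real.rpow_sub_one (by positivity)]
  field_simp
  ring

variable [FiniteDimensional ℝ E] [MeasurableSpace E] [BorelSpace E]

lemma integral_heatKernel (ht : 0 < t) : ∫ z : E, heatKernel t z = 1 := by
  have hrw : ∀ z : E, heatKernel t z = (2 * Real.pi * t) ^ (-(Module.finrank ℝ E : ℝ) / 2) *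
      Real.exp (-(1 / (2 * t)) * ‖z‖ ^ 2) := fun z => by
    rw [heatKernel]
    ring_nf
  simp_rw [hrw]
  rw [integral_const_mul, GaussianFourier.integral_rexp_neg_mul_sq_norm (by positivity),
    show Real.pi / (1 / (2 * t)) = 2 * Real.pi * t by field_simp, ← Real.rpow_add (by positivity),
    neg_div, neg_add_cancel, Real.rpow_zero]

lemma integrable_heatKernel (ht : 0 < t) : Integrable (heatKernel t : E → ℝ) :=
  .of_integral_ne_zero (by simp [integral_heatKernel ht])

lemma integrable_one_add_norm_sq_mul_heatKernel (ht : 0 < t) :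
    Integrable fun z : E => (1 + ‖z‖ ^ 2) * heatKernel t z := by
  obtain ⟨C, -, hle⟩ := exists_one_add_norm_sq_mul_heatKernel_le (E := E) ht le_rfl
  refine ((integrable_heatKernel (by positivity : 0 < 2 * t)).const_mul C).mono' (by fun_prop)
    (Filter.Eventually.of_forall fun z => ?_)
  have := heatKernel_pos ht z
  rw [Real.norm_of_nonneg (by positivity)]
  exact hle t ⟨le_rfl, le_rfl⟩ z

lemma integrable_heatKernel_mul_mul (ht : 0 < t) {c u : E → ℝ} (hc : Continuous c) {C : ℝ}
    (hle : ∀ z, |c z| ≤ C * (1 + ‖z‖ ^ 2)) (hu : Continuous u)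
    (hu_int : Integrable fun z => (1 + ‖z‖ ^ 2) * heatKernel t z * u z) :
    Integrable fun z => heatKernel t z * c z * u z := by
  refine (hu_int.norm.const_mul C).mono' (by fun_prop) (Filter.Eventually.of_forall fun z => ?_)
  have := heatKernel_pos ht z
  simp only [norm_mul, Real.norm_eq_abs, abs_of_pos this,
    abs_of_pos (by positivity : 0 < 1 + ‖z‖ ^ 2), ← mul_assoc]
  rw [mul_comm _ |c z|]
  gcongr
  exact hle z

lemma integrable_heatKernel_mul_inner_sq (ht : 0 < t) (v : E) {u : E → ℝ} (hu : Continuous u)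
    (hu_int : Integrable fun z => (1 + ‖z‖ ^ 2) * heatKernel t z * u z) :
    Integrable fun z => heatKernel t z * (‖v‖ ^ 2 - inner ℝ v z ^ 2 / t) * u z := by
  refine integrable_heatKernel_mul_mul ht (by fun_prop) (C := ‖v‖ ^ 2 * (1 + 1 / t))
    (fun z => ?_) hu hu_int
  calc |‖v‖ ^ 2 - inner ℝ v z ^ 2 / t| ≤ ‖v‖ ^ 2 + inner ℝ v z ^ 2 / t := by
        refine (abs_sub _ _).trans_eq ?_
        rw [abs_of_nonneg (by positivity), abs_of_nonneg (by positivity)]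
    _ ≤ ‖v‖ ^ 2 + (‖v‖ * ‖z‖) ^ 2 / t + (‖v‖ ^ 2 / t + ‖v‖ ^ 2 * ‖z‖ ^ 2) := by
        rw [← sq_abs (inner ℝ v z)]
        refine le_add_of_le_of_nonneg ?_ (by positivity)
        gcongr
        exact abs_real_inner_le_norm v z
    _ = ‖v‖ ^ 2 * (1 + 1 / t) * (1 + ‖z‖ ^ 2) := by ring

lemma integral_heatKernel_mul_inner_sq (ht : 0 < t) (v : E) {u : E → ℝ} {u' : E → E}
    (hu : ∀ z, HasGradientAt u (u' z) z)
    (hu_int : Integrable fun z => (1 + ‖z‖ ^ 2) * heatKernel t z * u z)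
    (hu'_int : Integrable fun z => heatKernel t z * (inner ℝ v z * inner ℝ v (u' z))) :
    ∫ z, heatKernel t z * (‖v‖ ^ 2 - inner ℝ v z ^ 2 / t) * u z =
      -∫ z, heatKernel t z * (inner ℝ v z * inner ℝ v (u' z)) := by
  have hu_deriv : ∀ z, fderiv ℝ u z v = inner ℝ v (u' z) := fun z => by
    rw [(hu z).hasFDerivAt.fderiv, InnerProductSpace.toDual_apply_apply, real_inner_comm]
  have hu_cont : Continuous u := continuous_iff_continuousAt.2 fun z => (hu z).continuousAt
  have hint : Integrable fun z => heatKernel t z * inner ℝ v z * u z := by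
    refine integrable_heatKernel_mul_mul ht (by fun_prop) (C := ‖v‖) (fun z => ?_) hu_cont hu_int
    refine (abs_real_inner_le_norm v z).trans ?_
    gcongr
    nlinarith [sq_nonneg (‖z‖ - 1)]
  have hparts := integral_mul_fderiv_eq_neg_fderiv_mul_of_integrable (μ := volume)
    (f := fun z => heatKernel t z * inner ℝ v z) (g := u) (v := v)
    (by simpa only [fderiv_heatKernel_mul_inner ht] using
      integrable_heatKernel_mul_inner_sq ht v hu_cont hu_int)
    (by simpa only [hu_deriv, mul_assoc] using hu'_int) hint
    (fun z _ => (hasGradientAt_heatKernel ht z).differentiableAt.mul (innerSL ℝ v).differentiableAt)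
    (fun z _ => (hu z).differentiableAt)
  simp only [fderiv_heatKernel_mul_inner ht, hu_deriv, mul_assoc] at hparts ⊢
  rw [hparts, neg_neg]

lemma measurable_of_hasGradientAt {u : E → ℝ} {u' : E → E}
    (hu : ∀ z, HasGradientAt u (u' z) z) : Measurable u' := by
  have : u' = fun z => (InnerProductSpace.toDual ℝ E).symm (fderiv ℝ u z) :=
    funext fun z => (hu z).gradient.symm
  rw [this]
  exact (InnerProductSpace.toDual ℝ E).symm.continuous.measurable.comp (measurable_fderiv ℝ u)

lemma integrable_heatKernel_mul_inner_mul_inner (ht : 0 < t) {v : E} (hv : ‖v‖ = 1) {F : E → E}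
    (hF : Measurable F) (hF_int : Integrable fun z => heatKernel t z * ‖F z‖ ^ 2) :
    Integrable fun z => heatKernel t z * (inner ℝ v z * inner ℝ v (F z)) := by
  refine ((integrable_one_add_norm_sq_mul_heatKernel ht).add hF_int).mono' (by fun_prop)
    (Filter.Eventually.of_forall fun z => ?_)
  have hg := heatKernel_pos ht z
  have hcoord : ∀ x : E, |inner ℝ v x| ≤ ‖x‖ := fun x =>
    (abs_real_inner_le_norm v x).trans_eq (by rw [hv, one_mul])
  rw [norm_mul, norm_mul, Real.norm_of_nonneg hg.le, Real.norm_eq_abs, Real.norm_eq_abs]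
  calc heatKernel t z * (|inner ℝ v z| * |inner ℝ v (F z)|)
      ≤ heatKernel t z * (‖z‖ * ‖F z‖) := by
        gcongr
        exacts [hcoord z, hcoord (F z)]
    _ ≤ heatKernel t z * (1 + ‖z‖ ^ 2 + ‖F z‖ ^ 2) := by
        gcongr
        nlinarith [sq_nonneg (‖z‖ - ‖F z‖), sq_nonneg (‖z‖ + ‖F z‖)]
    _ = (1 + ‖z‖ ^ 2) * heatKernel t z + heatKernel t z * ‖F z‖ ^ 2 := by ring

/-- The heat equation `∂ₜ g = Δ g / 2` of the kernel in weak form. -/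
lemma integral_heatKernelDeriv_mul (ht : 0 < t) {u : E → ℝ} {u' : E → E}
    (hu : ∀ z, HasGradientAt u (u' z) z)
    (hu_int : Integrable fun z => (1 + ‖z‖ ^ 2) * heatKernel t z * u z)
    (hu'_int : Integrable fun z => heatKernel t z * ‖u' z‖ ^ 2) :
    ∫ z, heatKernelDeriv t z * u z = -(1 / 2) * ∫ z, inner ℝ (heatKernelGradient t z) (u' z) := by
  have hu_cont : Continuous u := continuous_iff_continuousAt.2 fun z => (hu z).continuousAt
  let e := stdOrthonormalBasis ℝ E
  have hint := fun i => integrable_heatKernel_mul_inner_mul_inner ht (e.norm_eq_one i)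
    (measurable_of_hasGradientAt hu) hu'_int
  have hderiv : ∀ z, heatKernelDeriv t z * u z = -(1 / (2 * t)) *
      ∑ i, heatKernel t z * (‖e i‖ ^ 2 - inner ℝ (e i) z ^ 2 / t) * u z := fun z => by
    rw [← Finset.sum_mul, ← Finset.mul_sum, Finset.sum_sub_distrib, ← Finset.sum_div,
      e.sum_sq_inner_right]
    simp only [heatKernelDeriv, OrthonormalBasis.norm_eq_one, one_pow, Finset.sum_const,
      Finset.card_univ, Fintype.card_fin, nsmul_eq_mul, mul_one]
    ring
  have hgradient : ∀ z, inner ℝ (heatKernelGradient t z) (u' z) =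
      -t⁻¹ * ∑ i, heatKernel t z * (inner ℝ (e i) z * inner ℝ (e i) (u' z)) := fun z => by
    simp_rw [← Finset.mul_sum, real_inner_comm z, e.sum_inner_mul_inner]
    rw [heatKernelGradient, real_inner_smul_left]
    ring
  simp_rw [hderiv, hgradient]
  rw [integral_const_mul, integral_const_mul,
    integral_finsetSum _ fun i _ => integrable_heatKernel_mul_inner_sq ht (e i) hu_cont hu_int,
    integral_finsetSum _ fun i _ => hint i,
    Finset.sum_congr rfl fun i _ => integral_heatKernel_mul_inner_sq ht (e i) hu hu_int (hint i),
    Finset.sum_neg_distrib]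
  ring

lemma integral_heatKernelDeriv (ht : 0 < t) : ∫ z : E, heatKernelDeriv t z = 0 := by
  simpa using integral_heatKernelDeriv_mul (E := E) ht (u := fun _ => 1)
    (fun z => hasGradientAt_const z (1 : ℝ))
    (by simpa using integrable_one_add_norm_sq_mul_heatKernel ht) (by simp)

lemma integral_heatKernel_mul_norm_sq (ht : 0 < t) :
    ∫ z : E, heatKernel t z * ‖z‖ ^ 2 = Module.finrank ℝ E * t := by
  have hint : Integrable fun z : E => heatKernel t z * ‖z‖ ^ 2 := by
    refine ((integrable_one_add_norm_sq_mul_heatKernel ht).sub (integrable_heatKernel ht)).congr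
      (Filter.Eventually.of_forall fun z => ?_)
    simp only [Pi.sub_apply]
    ring
  have hderiv := integral_heatKernelDeriv (E := E) ht
  have hrw : ∀ z : E, heatKernelDeriv t z = 1 / (2 * t ^ 2) * (heatKernel t z * ‖z‖ ^ 2) -
      Module.finrank ℝ E / (2 * t) * heatKernel t z := fun z => by
    rw [heatKernelDeriv]
    ring
  simp_rw [hrw] at hderiv
  rw [integral_sub (hint.const_mul _) ((integrable_heatKernel ht).const_mul _),
    integral_const_mul, integral_const_mul, integral_heatKernel ht] at hderiv
  field_simp at hderiv
  linarith

lemma integral_heatKernel_smul_self (t : ℝ) : ∫ z : E, heatKernel t z • z = 0 := by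
  have : IsAddTorsionFree E := .of_isTorsionFree ℝ E
  have h := integral_neg_eq_self (fun z : E => heatKernel t z • z) volume
  simp only [heatKernel_neg, smul_neg, integral_neg] at h
  exact self_eq_neg.1 h.symm

lemma isProbabilityMeasure_withDensity_heatKernel (ht : 0 < t) : IsProbabilityMeasure
    ((volume : Measure E).withDensity fun z => ENNReal.ofReal (heatKernel t z)) := by
  constructor
  rw [withDensity_apply _ MeasurableSet.univ, Measure.restrict_univ,
    ← ofReal_integral_eq_lintegral_ofReal (integrable_heatKernel ht)
      (Filter.Eventually.of_forall fun z => (heatKernel_pos ht z).le),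
    integral_heatKernel ht, ENNReal.ofReal_one]

lemma charFun_withDensity_heatKernel (ht : 0 < t) (x : E) :
    charFun (volume.withDensity fun z => ENNReal.ofReal (heatKernel t z)) x =
      Complex.exp (-(t * ‖x‖ ^ 2 / 2)) := by
  rw [charFun_apply, integral_withDensity_eq_integral_toReal_smul (by fun_prop) (by simp)]
  have hrw : ∀ z : E, (ENNReal.ofReal (heatKernel t z)).toReal •
      Complex.exp (inner ℝ z x * Complex.I) =
        (((2 * Real.pi * t) ^ (-(Module.finrank ℝ E : ℝ) / 2) : ℝ) : ℂ) *
          Complex.exp (-((1 / (2 * t) : ℝ) : ℂ) * ‖z‖ ^ 2 + Complex.I * inner ℝ x z) := fun z => by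
    rw [ENNReal.toReal_ofReal (heatKernel_pos ht z).le, heatKernel, Complex.real_smul,
      Complex.exp_add, Complex.ofReal_mul, Complex.ofReal_exp, real_inner_comm, mul_assoc,
      mul_comm Complex.I]
    push_cast
    ring_nf
  have hpow : (2 * Real.pi * t) ^ (-(Module.finrank ℝ E : ℝ) / 2) *
      (2 * Real.pi * t) ^ ((Module.finrank ℝ E : ℝ) / 2) = 1 := by
    rw [← Real.rpow_add (by positivity), neg_div, neg_add_cancel, Real.rpow_zero]
  simp_rw [hrw]
  rw [integral_const_mul, GaussianFourier.integral_cexp_neg_mul_sq_norm_add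
      (by rw [Complex.ofReal_re]; positivity) Complex.I x,
    ← Complex.ofReal_div, show Real.pi / (1 / (2 * t)) = 2 * Real.pi * t by field_simp,
    show ((Module.finrank ℝ E : ℂ) / 2) = ((Module.finrank ℝ E / 2 : ℝ) : ℂ) by push_cast; rfl,
    ← Complex.ofReal_cpow (by positivity), ← mul_assoc, ← Complex.ofReal_mul, hpow,
    Complex.ofReal_one, one_mul, Complex.I_sq]
  congr 1
  push_cast
  field_simp
  norm_num

lemma multivariateGaussian_zero_smul_one {ι : Type*} [Fintype ι] [DecidableEq ι] (ht : 0 < t) :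
    multivariateGaussian 0 (t • (1 : Matrix ι ι ℝ)) =
      volume.withDensity fun z => ENNReal.ofReal (heatKernel t z) := by
  have := isProbabilityMeasure_withDensity_heatKernel (E := EuclideanSpace ℝ ι) ht
  refine Measure.ext_of_charFun (funext fun x => ?_)
  have hx : (x.ofLp ⬝ᵥ x.ofLp : ℝ) = ‖x‖ ^ 2 := by
    rw [EuclideanSpace.real_norm_sq_eq]
    simp [dotProduct, sq]
  rw [charFun_multivariateGaussian (Matrix.PosSemidef.one.smul ht.le),
    charFun_withDensity_heatKernel ht]
  simp [Matrix.smul_mulVec, hx]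

end HeatKernel

lemma integral_norm_sub_sq_eq_norm_sub_integral_sq_add {Ω E : Type*} [MeasurableSpace Ω]
    {μ : Measure Ω} [IsProbabilityMeasure μ] [NormedAddCommGroup E] [InnerProductSpace ℝ E]
    [CompleteSpace E] {X : Ω → E} (hX : MemLp X 2 μ) (y : E) :
    ∫ ω, ‖y - X ω‖ ^ 2 ∂μ = ‖y - ∫ ω, X ω ∂μ‖ ^ 2 + ∫ ω, ‖(∫ ω, X ω ∂μ) - X ω‖ ^ 2 ∂μ := by
  set m := ∫ ω, X ω ∂μ with hm
  have hcenter : MemLp (fun ω => m - X ω) 2 μ := (memLp_const m).sub hX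
  have hcenter_int : Integrable (fun ω => m - X ω) μ := hcenter.integrable one_le_two
  have hexpand : ∀ ω, ‖y - X ω‖ ^ 2 =
      ‖y - m‖ ^ 2 + 2 * inner ℝ (y - m) (m - X ω) + ‖m - X ω‖ ^ 2 := fun ω => by
    rw [← norm_add_sq_real, sub_add_sub_cancel]
  have hcenter_mean : ∫ ω, (m - X ω) ∂μ = 0 := by
    rw [integral_sub (integrable_const m) (hX.integrable one_le_two), ← hm]
    simp only [integral_const, probReal_univ, one_smul, sub_self]
  have hinner := (hcenter_int.const_inner (𝕜 := ℝ) (y - m)).const_mul 2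
  simp_rw [hexpand]
  rw [integral_add (by fun_prop) (hcenter.integrable_norm_pow two_ne_zero),
    integral_add (integrable_const _) hinner, integral_const_mul, integral_inner hcenter_int,
    hcenter_mean]
  simp only [integral_const, probReal_univ, one_smul, inner_zero_right, mul_zero, add_zero]

noncomputable section HeatFlow

variable {E : Type*} [NormedAddCommGroup E] [InnerProductSpace ℝ E] [MeasurableSpace E]

/-- The density of the convolution of `ν` with the centred Gaussian law of covariance `t • 1`:
the heat flow at time `t` started at `ν`. -/
def heatDensity (ν : Measure E) (t : ℝ) (y : E) : ℝ :=
  ∫ w, heatKernel t (y - w) ∂ν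

/-- The spatial gradient of `heatDensity`. -/
def heatGradient (ν : Measure E) (t : ℝ) (y : E) : E :=
  ∫ w, heatKernelGradient t (y - w) ∂ν

/-- The time derivative of `heatDensity`. -/
def heatDensityDeriv (ν : Measure E) (t : ℝ) (y : E) : ℝ :=
  ∫ w, heatKernelDeriv t (y - w) ∂ν

/-- The score `∇ log p` of the heat flow `p = heatDensity ν t`, written as `∇ p / p`. -/
def heatScore (ν : Measure E) (t : ℝ) (y : E) : E :=
  (heatDensity ν t y)⁻¹ • heatGradient ν t y

variable [BorelSpace E] [FiniteDimensional ℝ E] {ν : Measure E} [IsFiniteMeasure ν] {t : ℝ}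

lemma integrable_heatKernel_sub (ht : 0 < t) (y : E) :
    Integrable (fun w => heatKernel t (y - w)) ν := by
  refine (integrable_const ((2 * Real.pi * t) ^ (-(Module.finrank ℝ E : ℝ) / 2))).mono'
    (by fun_prop) (Filter.Eventually.of_forall fun w => ?_)
  rw [Real.norm_of_nonneg (heatKernel_pos ht _).le]
  exact heatKernel_le ht _

lemma integrable_heatKernelGradient_sub (ht : 0 < t) (y : E) :
    Integrable (fun w => heatKernelGradient t (y - w)) ν := by
  obtain ⟨C, hC⟩ := exists_norm_heatKernelGradient_le (E := E) ht
  exact (integrable_const C).mono' (by fun_prop) (Filter.Eventually.of_forall fun w => hC _)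

lemma heatDensity_pos [NeZero ν] (ht : 0 < t) (y : E) : 0 < heatDensity ν t y := by
  have hsupport : Function.support (fun w => heatKernel t (y - w)) = univ :=
    Set.eq_univ_of_forall fun w => (heatKernel_pos ht _).ne'
  rw [heatDensity, integral_pos_iff_support_of_nonneg (fun w => (heatKernel_pos ht _).le)
    (integrable_heatKernel_sub ht y), hsupport]
  exact Measure.measure_univ_pos.2 (NeZero.ne ν)

lemma hasGradientAt_heatDensity (ht : 0 < t) (y : E) :
    HasGradientAt (heatDensity ν t) (heatGradient ν t y) y := by
  obtain ⟨C, hC⟩ := exists_norm_heatKernelGradient_le (E := E) ht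
  have hderiv : ∀ w x : E, HasFDerivAt (fun y => heatKernel t (y - w))
      (innerSL ℝ (heatKernelGradient t (x - w))) x := fun w x => by
    refine ((hasGradientAt_heatKernel ht (x - w)).hasFDerivAt.comp x
      ((hasFDerivAt_id x).sub_const w)).congr_fderiv ?_
    ext
    simp
  rw [hasGradientAt_iff_hasFDerivAt]
  refine (hasFDerivAt_integral_of_dominated_of_fderiv_le (μ := ν) (s := univ)
    (bound := fun _ => C) Filter.univ_mem
    (Filter.Eventually.of_forall fun x => by fun_prop) (integrable_heatKernel_sub ht y)
    (by fun_prop) (Filter.Eventually.of_forall fun w x _ => ?_) (integrable_const C)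
    (Filter.Eventually.of_forall fun w x _ => hderiv w x)).congr_fderiv ?_
  · rw [innerSL_apply_norm]
    exact hC _
  · exact (innerSL ℝ).integral_comp_comm (integrable_heatKernelGradient_sub ht y)

@[fun_prop]
lemma continuous_heatDensity (ht : 0 < t) : Continuous (heatDensity ν t) :=
  continuous_iff_continuousAt.2 fun y => (hasGradientAt_heatDensity ht y).continuousAt

lemma continuous_heatGradient (ht : 0 < t) : Continuous (heatGradient ν t) := by
  obtain ⟨C, hC⟩ := exists_norm_heatKernelGradient_le (E := E) ht
  exact continuous_of_dominated (fun y => by fun_prop)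
    (fun y => Filter.Eventually.of_forall fun w => hC _) (integrable_const C)
    (Filter.Eventually.of_forall fun w => by fun_prop)

lemma contDiff_heatDensity (ht : 0 < t) : ContDiff ℝ 1 (heatDensity ν t) := by
  have hfderiv : fderiv ℝ (heatDensity ν t) =
      fun y => InnerProductSpace.toDual ℝ E (heatGradient ν t y) :=
    funext fun y => (hasGradientAt_heatDensity ht y).hasFDerivAt.fderiv
  rw [contDiff_one_iff_fderiv, hfderiv]
  exact ⟨fun y => (hasGradientAt_heatDensity ht y).differentiableAt,
    (LinearIsometryEquiv.continuous _).comp (continuous_heatGradient ht)⟩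

lemma heatDensity_smul_heatScore [NeZero ν] (ht : 0 < t) (y : E) :
    heatDensity ν t y • heatScore ν t y = heatGradient ν t y :=
  smul_inv_smul₀ (heatDensity_pos ht y).ne' _

lemma hasGradientAt_log_heatDensity [NeZero ν] (ht : 0 < t) (y : E) :
    HasGradientAt (fun z => Real.log (heatDensity ν t z)) (heatScore ν t y) y := by
  rw [hasGradientAt_iff_hasFDerivAt]
  refine ((hasGradientAt_heatDensity ht y).hasFDerivAt.log
    (heatDensity_pos ht y).ne').congr_fderiv ?_
  simp [heatScore]

lemma continuous_heatScore [NeZero ν] (ht : 0 < t) : Continuous (heatScore ν t) :=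
  ((continuous_heatDensity ht).inv₀ fun y => (heatDensity_pos ht y).ne').smul
    (continuous_heatGradient ht)

lemma continuous_log_heatDensity [NeZero ν] (ht : 0 < t) :
    Continuous fun y => Real.log (heatDensity ν t y) :=
  (continuous_heatDensity ht).log fun y => (heatDensity_pos ht y).ne'

lemma hasDerivAt_heatDensity (ht : 0 < t) (y : E) :
    HasDerivAt (fun s => heatDensity ν s y) (heatDensityDeriv ν t y) t := by
  obtain ⟨C, hC⟩ := exists_abs_heatKernelDeriv_le (E := E) (half_pos ht)
    (by linarith : t / 2 ≤ 2 * t)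
  exact (hasDerivAt_integral_of_dominated_loc_of_deriv_le (μ := ν)
    (F := fun s w => heatKernel s (y - w)) (F' := fun s w => heatKernelDeriv s (y - w))
    (bound := fun w => C * heatKernel (2 * (2 * t)) (y - w))
    (Icc_mem_nhds (by linarith : t / 2 < t) (by linarith : t < 2 * t))
    (Filter.Eventually.of_forall fun s => by fun_prop) (integrable_heatKernel_sub ht y)
    (by fun_prop) (Filter.Eventually.of_forall fun w s hs => hC s hs (y - w))
    ((integrable_heatKernel_sub (by positivity) y).const_mul C)
    (Filter.Eventually.of_forall fun w s hs =>
      hasDerivAt_heatKernel (by linarith [hs.1]) (y - w))).2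

lemma exists_abs_heatDensityDeriv_le (ν : Measure E) [IsFiniteMeasure ν] {a b : ℝ} (ha : 0 < a)
    (hab : a ≤ b) : ∃ C : ℝ, ∀ t ∈ Icc a b, ∀ y,
      |heatDensityDeriv ν t y| ≤ C * heatDensity ν (2 * b) y := by
  obtain ⟨C, hC⟩ := exists_abs_heatKernelDeriv_le (E := E) ha hab
  refine ⟨C, fun t ht y => ?_⟩
  rw [heatDensity, ← integral_const_mul, ← Real.norm_eq_abs]
  exact norm_integral_le_of_norm_le
    ((integrable_heatKernel_sub (by linarith : 0 < 2 * b) y).const_mul C)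
    (Filter.Eventually.of_forall fun w => hC t ht (y - w))

lemma abs_log_heatDensity_add_le {ν : Measure E} [IsProbabilityMeasure ν] (hν : MemLp id 2 ν)
    (ht : 0 < t) (y : E) :
    |Real.log (heatDensity ν t y) + Module.finrank ℝ E / 2 * Real.log (2 * Real.pi * t)| ≤
      (∫ w, ‖y - w‖ ^ 2 ∂ν) / (2 * t) := by
  set c : ℝ := (2 * Real.pi * t) ^ (-(Module.finrank ℝ E : ℝ) / 2) with hc
  have hc_pos : 0 < c := by positivity
  have hlog_c : Real.log c = -(Module.finrank ℝ E / 2 * Real.log (2 * Real.pi * t)) := by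
    rw [hc, Real.log_rpow (by positivity)]
    ring
  have hupper : heatDensity ν t y ≤ c := by
    simpa [heatDensity] using integral_mono (μ := ν) (integrable_heatKernel_sub ht y)
      (integrable_const c) fun w => heatKernel_le ht (y - w)
  have hlower : c * Real.exp (∫ w, -‖y - w‖ ^ 2 / (2 * t) ∂ν) ≤ heatDensity ν t y := by
    have hsq : Integrable (fun w => ‖y - w‖ ^ 2) ν :=
      ((memLp_const y).sub hν).integrable_norm_pow two_ne_zero
    have hexp : Integrable (fun w => Real.exp (-‖y - w‖ ^ 2 / (2 * t))) ν := by
      refine ((integrable_heatKernel_sub ht y).const_mul c⁻¹).congr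
        (Filter.Eventually.of_forall fun w => ?_)
      simp only [heatKernel, ← hc]
      field_simp
    rw [heatDensity]
    simp only [heatKernel, ← hc]
    rw [integral_const_mul]
    gcongr
    exact convexOn_exp.map_integral_le Real.continuous_exp.continuousOn isClosed_univ (by simp)
      (hsq.neg.div_const _) hexp
  have hlog_upper := Real.log_le_log (heatDensity_pos ht y) hupper
  have hlog_lower := Real.log_le_log (by positivity) hlower
  rw [Real.log_mul (by positivity) (by positivity), Real.log_exp, integral_div, integral_neg,
    neg_div, hlog_c] at hlog_lower
  have : 0 ≤ (∫ w, ‖y - w‖ ^ 2 ∂ν) / (2 * t) := by positivity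
  rw [abs_le]
  constructor <;> linarith

lemma exists_abs_log_heatDensity_le {ν : Measure E} [IsProbabilityMeasure ν] (hν : MemLp id 2 ν)
    {a b : ℝ} (ha : 0 < a) :
    ∃ C : ℝ, ∀ t ∈ Icc a b, ∀ y, |Real.log (heatDensity ν t y)| ≤ C * (1 + ‖y‖ ^ 2) := by
  obtain ⟨K, hK⟩ := isCompact_Icc.exists_bound_of_continuousOn (s := Icc a b)
    (f := fun s => Module.finrank ℝ E / 2 * Real.log (2 * Real.pi * s)) (by
      refine continuousOn_const.mul (ContinuousOn.log (by fun_prop) fun s hs => ?_)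
      have := ha.trans_le hs.1
      positivity)
  set m := ∫ w, w ∂ν
  set V := ∫ w, ‖m - w‖ ^ 2 ∂ν
  have : 0 ≤ V := integral_nonneg fun w => by positivity
  refine ⟨|K| + (2 + 2 * ‖m‖ ^ 2 + V) / (2 * a), fun t ht y => ?_⟩
  have hsq : ∫ w, ‖y - w‖ ^ 2 ∂ν ≤ (2 + 2 * ‖m‖ ^ 2 + V) * (1 + ‖y‖ ^ 2) := by
    calc ∫ w, ‖y - w‖ ^ 2 ∂ν = ‖y - m‖ ^ 2 + V :=
          integral_norm_sub_sq_eq_norm_sub_integral_sq_add hν y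
      _ ≤ 2 * ‖y‖ ^ 2 + 2 * ‖m‖ ^ 2 + V := by
          nlinarith [parallelogram_law_with_norm ℝ y m, sq_nonneg ‖y + m‖]
      _ ≤ 2 * ‖y‖ ^ 2 + 2 * ‖m‖ ^ 2 + V + (2 + (2 * ‖m‖ ^ 2 + V) * ‖y‖ ^ 2) :=
          le_add_of_nonneg_right (by positivity)
      _ = (2 + 2 * ‖m‖ ^ 2 + V) * (1 + ‖y‖ ^ 2) := by ring
  have hta : 0 < t := ha.trans_le ht.1
  calc |Real.log (heatDensity ν t y)|
      ≤ |Real.log (heatDensity ν t y) + Module.finrank ℝ E / 2 * Real.log (2 * Real.pi * t)| +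
          |Module.finrank ℝ E / 2 * Real.log (2 * Real.pi * t)| := by
        simpa using abs_sub (Real.log (heatDensity ν t y) +
          Module.finrank ℝ E / 2 * Real.log (2 * Real.pi * t))
          (Module.finrank ℝ E / 2 * Real.log (2 * Real.pi * t))
    _ ≤ (2 + 2 * ‖m‖ ^ 2 + V) * (1 + ‖y‖ ^ 2) / (2 * a) + |K| * (1 + ‖y‖ ^ 2) := by
        gcongr
        · refine (abs_log_heatDensity_add_le hν hta y).trans ?_
          gcongr
          exact ht.1
        · refine (hK t ht).trans ((le_abs_self K).trans ?_)
          exact le_mul_of_one_le_right (abs_nonneg K) (by linarith [sq_nonneg ‖y‖])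
    _ = _ := by ring

end HeatFlow

section ConditionalExpectation

variable {Ω E : Type*} {m m0 : MeasurableSpace Ω} {μ : Measure Ω}
  [NormedAddCommGroup E] [InnerProductSpace ℝ E]

lemma integrable_inner_of_memLp_two {S V : Ω → E} (hS : MemLp S 2 μ) (hV : MemLp V 2 μ) :
    Integrable (fun ω => inner ℝ (S ω) (V ω)) μ :=
  (hS.norm.integrable_mul hV.norm).mono' (hS.1.inner hV.1)
    (Filter.Eventually.of_forall fun _ => norm_inner_le_norm _ _)

variable [CompleteSpace E] [IsFiniteMeasure μ]

lemma integral_inner_sub_condExp (hm : m ≤ m0) {D S : Ω → E} (hD : MemLp D 2 μ)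
    (hDm : AEStronglyMeasurable[m] D μ) (hS : MemLp S 2 μ) :
    ∫ ω, inner ℝ (D ω) (S ω - μ[S | m] ω) ∂μ = 0 := by
  have hDS := integrable_inner_of_memLp_two hD hS
  have hpull : μ[fun ω => inner ℝ (D ω) (S ω) | m] =ᵐ[μ] fun ω => inner ℝ (D ω) (μ[S | m] ω) :=
    condExp_bilin_of_aestronglyMeasurable_left (innerSL ℝ) hDm hDS (hS.integrable one_le_two)
  simp_rw [inner_sub_right]
  rw [integral_sub hDS (integrable_inner_of_memLp_two hD (hS.condExp one_le_two)),
    ← integral_congr_ae hpull, integral_condExp hm, sub_self]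

lemma integral_norm_sub_sq_eq_add_condExp (hm : m ≤ m0) {S V : Ω → E} (hS : MemLp S 2 μ)
    (hV : MemLp V 2 μ) (hVm : AEStronglyMeasurable[m] V μ) :
    ∫ ω, ‖S ω - V ω‖ ^ 2 ∂μ =
      ∫ ω, ‖S ω - μ[S | m] ω‖ ^ 2 ∂μ + ∫ ω, ‖μ[S | m] ω - V ω‖ ^ 2 ∂μ := by
  have hcond : MemLp (μ[S | m]) 2 μ := hS.condExp one_le_two
  have hbias : MemLp (fun ω => μ[S | m] ω - V ω) 2 μ := hcond.sub hV
  have herror : MemLp (fun ω => S ω - μ[S | m] ω) 2 μ := hS.sub hcond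
  have hexpand : ∀ ω, ‖S ω - V ω‖ ^ 2 = ‖μ[S | m] ω - V ω‖ ^ 2 +
      2 * inner ℝ (μ[S | m] ω - V ω) (S ω - μ[S | m] ω) + ‖S ω - μ[S | m] ω‖ ^ 2 := fun ω => by
    rw [← norm_add_sq_real, add_comm, sub_add_sub_cancel]
  have hbias_sq := hbias.integrable_norm_pow two_ne_zero
  have hcross := (integrable_inner_of_memLp_two hbias herror).const_mul 2
  simp_rw [hexpand]
  rw [integral_add (by fun_prop) (herror.integrable_norm_pow two_ne_zero),
    integral_add hbias_sq hcross, integral_const_mul,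
    integral_inner_sub_condExp hm hbias
      (stronglyMeasurable_condExp.aestronglyMeasurable.sub hVm) hS]
  ring

/-- Knowing `U + V`, an error in estimating `U` is an opposite error in estimating `V`. -/
lemma sub_condExp_comap_add_ae_eq_neg [MeasurableSpace E] [BorelSpace E]
    [SecondCountableTopology E] {U V : Ω → E} (hU : Integrable U μ) (hV : Integrable V μ)
    (hUV : Measurable (U + V)) :
    U - μ[U | MeasurableSpace.comap (U + V) inferInstance] =ᵐ[μ]
      -(V - μ[V | MeasurableSpace.comap (U + V) inferInstance]) := by
  have hself : μ[U + V | MeasurableSpace.comap (U + V) inferInstance] = U + V :=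
    condExp_of_stronglyMeasurable hUV.comap_le (comap_measurable (U + V)).stronglyMeasurable
      (hU.add hV)
  have hadd := condExp_add hU hV (MeasurableSpace.comap (U + V) inferInstance)
  rw [hself] at hadd
  filter_upwards [hadd] with ω hω
  simp only [Pi.add_apply] at hω
  simp only [Pi.sub_apply, Pi.neg_apply, neg_sub]
  rw [sub_eq_sub_iff_add_eq_add, hω, add_comm]

end ConditionalExpectation

section KullbackLeibler

variable {α β : Type*} [MeasurableSpace α] [MeasurableSpace β] {ν : Measure α}

lemma map_withDensity_comp {φ : α → β} (hφ : Measurable φ) {ρ : β → ENNReal}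
    (hρ : Measurable ρ) :
    (ν.withDensity (ρ ∘ φ)).map φ = (ν.map φ).withDensity ρ := by
  ext s hs
  rw [Measure.map_apply hφ hs, withDensity_apply _ (hφ hs), withDensity_apply _ hs,
    setLIntegral_map hs hρ hφ]
  rfl

lemma klDiv_withDensity_left [IsFiniteMeasure ν] {ρ : α → ENNReal} (hρ : Measurable ρ)
    [IsFiniteMeasure (ν.withDensity ρ)] :
    klDiv (ν.withDensity ρ) ν = ∫⁻ x, ENNReal.ofReal (klFun (ρ x).toReal) ∂ν := by
  rw [klDiv_eq_lintegral_klFun_of_ac (withDensity_absolutelyContinuous ν ρ)]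
  refine lintegral_congr_ae ?_
  filter_upwards [Measure.rnDeriv_withDensity ν hρ] with x hx
  rw [hx]

/-- A map through which the likelihood ratio factors is a sufficient statistic: it loses none of
the divergence. -/
lemma klDiv_map_withDensity_comp [IsFiniteMeasure ν] {φ : α → β} (hφ : Measurable φ)
    {ρ : β → ENNReal} (hρ : Measurable ρ) [IsFiniteMeasure (ν.withDensity (ρ ∘ φ))] :
    klDiv ((ν.withDensity (ρ ∘ φ)).map φ) (ν.map φ) = klDiv (ν.withDensity (ρ ∘ φ)) ν := by
  have hfinite : IsFiniteMeasure ((ν.map φ).withDensity ρ) := by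
    rw [← map_withDensity_comp hφ hρ]
    infer_instance
  have := measurable_klFun
  rw [map_withDensity_comp hφ hρ, klDiv_withDensity_left hρ,
    klDiv_withDensity_left (hρ.comp hφ), lintegral_map (by fun_prop) hφ]
  rfl

end KullbackLeibler

section WithDensity

variable {Ω β F : Type*} [MeasurableSpace Ω] [MeasurableSpace β] {μ : Measure Ω} {Q : Measure β}
  [NormedAddCommGroup F] [NormedSpace ℝ F] {T : Ω → β} {ρ : β → ℝ} {φ : β → F}

lemma integrable_comp_iff_of_map_eq_withDensity (hT : Measurable T) (hρ : Measurable ρ)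
    (hρ_nonneg : ∀ x, 0 ≤ ρ x) (hlaw : μ.map T = Q.withDensity fun x => ENNReal.ofReal (ρ x))
    (hφ : StronglyMeasurable φ) :
    Integrable (fun ω => φ (T ω)) μ ↔ Integrable (fun x => ρ x • φ x) Q := by
  rw [← Function.comp_def φ T, ← integrable_map_measure hφ.aestronglyMeasurable hT.aemeasurable,
    hlaw, integrable_withDensity_iff_integrable_smul' (by fun_prop) (by simp)]
  simp_rw [ENNReal.toReal_ofReal (hρ_nonneg _)]

lemma integral_comp_of_map_eq_withDensity (hT : Measurable T) (hρ : Measurable ρ)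
    (hρ_nonneg : ∀ x, 0 ≤ ρ x) (hlaw : μ.map T = Q.withDensity fun x => ENNReal.ofReal (ρ x))
    (hφ : StronglyMeasurable φ) :
    ∫ ω, φ (T ω) ∂μ = ∫ x, ρ x • φ x ∂Q := by
  rw [← integral_map hT.aemeasurable hφ.aestronglyMeasurable, hlaw,
    integral_withDensity_eq_integral_toReal_smul (by fun_prop) (by simp)]
  simp_rw [ENNReal.toReal_ofReal (hρ_nonneg _)]

end WithDensity

section GaussianNoise

variable {Ω α E : Type*} [MeasurableSpace Ω] [MeasurableSpace α] [NormedAddCommGroup E]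
  [InnerProductSpace ℝ E] [FiniteDimensional ℝ E] [MeasurableSpace E] [BorelSpace E]

/-- `Z` is a centred Gaussian vector of covariance `t • 1`, independent of the input `U`: the noise
at time `t` of the channels with outputs `f ∘ U + Z`. -/
structure IsGaussianNoise (U : Ω → α) (Z : Ω → E) (t : ℝ) (μ : Measure Ω) : Prop where
  pos : 0 < t
  measurable_input : Measurable U
  measurable_noise : Measurable Z
  map_noise : μ.map Z = volume.withDensity fun z => ENNReal.ofReal (heatKernel t z)
  indepFun : IndepFun U Z μ

lemma isGaussianNoise_fst_snd {t : ℝ} (ht : 0 < t) (ν : Measure α) [IsProbabilityMeasure ν] :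
    IsGaussianNoise (Prod.fst : α × E → α) Prod.snd t
      (ν.prod (volume.withDensity fun z => ENNReal.ofReal (heatKernel t z))) where
  pos := ht
  measurable_input := measurable_fst
  measurable_noise := measurable_snd
  map_noise := Measure.map_snd_prod.trans (by simp)
  indepFun := by
    have := isProbabilityMeasure_withDensity_heatKernel (E := E) ht
    exact indepFun_prod measurable_id measurable_id

namespace IsGaussianNoise

variable {μ : Measure Ω} {t : ℝ} {U : Ω → α} {f : α → E} {W Z : Ω → E}

lemma comp {β : Type*} [MeasurableSpace β] {g : α → β} (h : IsGaussianNoise U Z t μ)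
    (hg : Measurable g) : IsGaussianNoise (g ∘ U) Z t μ where
  pos := h.pos
  measurable_input := hg.comp h.measurable_input
  measurable_noise := h.measurable_noise
  map_noise := h.map_noise
  indepFun := h.indepFun.comp hg measurable_id

lemma measurable_add (h : IsGaussianNoise W Z t μ) : Measurable (W + Z) :=
  h.measurable_input.add h.measurable_noise

lemma memLp_id_map_iff (h : IsGaussianNoise W Z t μ) : MemLp id 2 (μ.map W) ↔ MemLp W 2 μ :=
  memLp_map_measure_iff aestronglyMeasurable_id h.measurable_input.aemeasurable

lemma memLp_noise (h : IsGaussianNoise U Z t μ) : MemLp Z 2 μ := by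
  rw [memLp_two_iff_integrable_sq_norm h.measurable_noise.aestronglyMeasurable,
    integrable_comp_iff_of_map_eq_withDensity h.measurable_noise (by fun_prop)
      (fun z => (heatKernel_pos h.pos z).le) h.map_noise (φ := fun z => ‖z‖ ^ 2)
      (by fun_prop)]
  refine ((integrable_one_add_norm_sq_mul_heatKernel h.pos).sub
    (integrable_heatKernel h.pos)).congr (Filter.Eventually.of_forall fun z => ?_)
  simp only [Pi.sub_apply, smul_eq_mul]
  ring

lemma memLp_add (h : IsGaussianNoise W Z t μ) (hW : MemLp W 2 μ) : MemLp (W + Z) 2 μ :=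
  hW.add h.memLp_noise

lemma integral_norm_noise_sq (h : IsGaussianNoise U Z t μ) :
    ∫ ω, ‖Z ω‖ ^ 2 ∂μ = Module.finrank ℝ E * t := by
  rw [integral_comp_of_map_eq_withDensity h.measurable_noise (by fun_prop)
    (fun z => (heatKernel_pos h.pos z).le) h.map_noise (φ := fun z => ‖z‖ ^ 2) (by fun_prop)]
  exact integral_heatKernel_mul_norm_sq h.pos

lemma integral_noise (h : IsGaussianNoise U Z t μ) : ∫ ω, Z ω ∂μ = 0 := by
  rw [integral_comp_of_map_eq_withDensity h.measurable_noise (by fun_prop)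
    (fun z => (heatKernel_pos h.pos z).le) h.map_noise (φ := fun z => z) (by fun_prop)]
  exact integral_heatKernel_smul_self t

variable [IsProbabilityMeasure μ]

lemma isProbabilityMeasure_map_input (h : IsGaussianNoise U Z t μ) :
    IsProbabilityMeasure (μ.map U) :=
  Measure.isProbabilityMeasure_map h.measurable_input.aemeasurable

lemma map_prodMk_comp_add (h : IsGaussianNoise U Z t μ) (hf : Measurable f) :
    μ.map (fun ω => (U ω, (f ∘ U + Z) ω)) = ((μ.map U).prod volume).withDensity
      fun q => ENNReal.ofReal (heatKernel t (q.2 - f q.1)) := by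
  have hU := h.measurable_input
  have hZ := h.measurable_noise
  have := h.isProbabilityMeasure_map_input
  have := isProbabilityMeasure_withDensity_heatKernel (E := E) h.pos
  have hshear : Measurable fun q : α × E => (q.1, f q.1 + q.2) := by fun_prop
  have hshear_map : μ.map (fun ω => (U ω, (f ∘ U + Z) ω)) =
      ((μ.map U).prod (μ.map Z)).map fun q => (q.1, f q.1 + q.2) := by
    rw [← (indepFun_iff_map_prod_eq_prod_map_map hU.aemeasurable hZ.aemeasurable).1 h.indepFun,
      Measure.map_map hshear (by fun_prop)]
    rfl
  rw [hshear_map, h.map_noise]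
  refine Measure.ext_of_lintegral _ fun F hF => ?_
  rw [lintegral_map hF hshear, prod_withDensity_right (by fun_prop),
    lintegral_withDensity_eq_lintegral_mul _ (by fun_prop) (by fun_prop),
    lintegral_withDensity_eq_lintegral_mul _ (by fun_prop) hF,
    lintegral_prod _ (by fun_prop), lintegral_prod _ (by fun_prop)]
  refine lintegral_congr fun u => ?_
  conv_rhs => rw [← lintegral_add_left_eq_self _ (f u)]
  simp

lemma map_prodMk_add (h : IsGaussianNoise W Z t μ) :
    μ.map (fun ω => (W ω, (W + Z) ω)) = ((μ.map W).prod volume).withDensity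
      fun q => ENNReal.ofReal (heatKernel t (q.2 - q.1)) :=
  h.map_prodMk_comp_add measurable_id

lemma map_add (h : IsGaussianNoise W Z t μ) :
    μ.map (W + Z) = volume.withDensity fun y => ENNReal.ofReal (heatDensity (μ.map W) t y) := by
  have := h.measurable_add
  have hW := h.measurable_input
  have := h.isProbabilityMeasure_map_input
  have hdensity := (continuous_heatDensity (ν := μ.map W) h.pos).measurable
  refine Measure.ext_of_lintegral _ fun F hF => ?_
  rw [← Measure.snd_map_prodMk hW, Measure.snd, h.map_prodMk_add,
    lintegral_map hF (by fun_prop),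
    lintegral_withDensity_eq_lintegral_mul _ (by fun_prop) (by fun_prop),
    lintegral_withDensity_eq_lintegral_mul _ (by fun_prop) hF,
    lintegral_prod_symm _ (by fun_prop)]
  refine lintegral_congr fun y => ?_
  simp only [Pi.mul_apply]
  rw [lintegral_mul_const _ (by fun_prop), heatDensity,
    ofReal_integral_eq_lintegral_ofReal (integrable_heatKernel_sub h.pos y)
      (Filter.Eventually.of_forall fun w => (heatKernel_pos h.pos _).le)]

section Transfer

variable {F : Type*} [NormedAddCommGroup F] [NormedSpace ℝ F]

lemma integrable_comp_prodMk_iff (h : IsGaussianNoise W Z t μ) {φ : E × E → F}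
    (hφ : StronglyMeasurable φ) :
    Integrable (fun ω => φ (W ω, (W + Z) ω)) μ ↔
      Integrable (fun q => heatKernel t (q.2 - q.1) • φ q) ((μ.map W).prod volume) :=
  integrable_comp_iff_of_map_eq_withDensity (h.measurable_input.prodMk h.measurable_add)
    (by fun_prop) (fun _ => (heatKernel_pos h.pos _).le) h.map_prodMk_add hφ

lemma integral_comp_prodMk (h : IsGaussianNoise W Z t μ) {φ : E × E → F}
    (hφ : StronglyMeasurable φ) :
    ∫ ω, φ (W ω, (W + Z) ω) ∂μ =
      ∫ q, heatKernel t (q.2 - q.1) • φ q ∂((μ.map W).prod volume) :=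
  integral_comp_of_map_eq_withDensity (h.measurable_input.prodMk h.measurable_add)
    (by fun_prop) (fun _ => (heatKernel_pos h.pos _).le) h.map_prodMk_add hφ

lemma integrable_comp_add_iff (h : IsGaussianNoise W Z t μ) {φ : E → F}
    (hφ : StronglyMeasurable φ) :
    Integrable (fun ω => φ ((W + Z) ω)) μ ↔
      Integrable fun y => heatDensity (μ.map W) t y • φ y := by
  have := h.isProbabilityMeasure_map_input
  exact integrable_comp_iff_of_map_eq_withDensity h.measurable_add
    (continuous_heatDensity h.pos).measurable (fun _ => (heatDensity_pos h.pos _).le) h.map_add hφ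

lemma integral_comp_add (h : IsGaussianNoise W Z t μ) {φ : E → F} (hφ : StronglyMeasurable φ) :
    ∫ ω, φ ((W + Z) ω) ∂μ = ∫ y, heatDensity (μ.map W) t y • φ y := by
  have := h.isProbabilityMeasure_map_input
  exact integral_comp_of_map_eq_withDensity h.measurable_add
    (continuous_heatDensity h.pos).measurable (fun _ => (heatDensity_pos h.pos _).le) h.map_add hφ

end Transfer

lemma integrable_prod_heatKernelGradient (h : IsGaussianNoise W Z t μ) :
    Integrable (fun q : E × E => heatKernelGradient t (q.2 - q.1)) ((μ.map W).prod volume) := by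
  have hnoise : Integrable (fun ω => (W + Z) ω - W ω) μ := by
    simpa using h.memLp_noise.integrable one_le_two
  rw [h.integrable_comp_prodMk_iff (φ := fun q => q.2 - q.1) (by fun_prop)] at hnoise
  refine (hnoise.smul (-t⁻¹)).congr (Filter.Eventually.of_forall fun q => ?_)
  simp only [Pi.smul_apply, heatKernelGradient, smul_smul]
  congr 1
  ring

lemma integrable_heatScore_add (h : IsGaussianNoise W Z t μ) :
    Integrable (fun ω => heatScore (μ.map W) t ((W + Z) ω)) μ := by
  have := h.isProbabilityMeasure_map_input
  rw [h.integrable_comp_add_iff (continuous_heatScore h.pos).stronglyMeasurable]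
  simp_rw [heatDensity_smul_heatScore h.pos]
  exact h.integrable_prod_heatKernelGradient.integral_prod_right

lemma setIntegral_heatScore_add (h : IsGaussianNoise W Z t μ) {A : Set E}
    (hA : MeasurableSet A) :
    ∫ ω in (W + Z) ⁻¹' A, -t • heatScore (μ.map W) t ((W + Z) ω) ∂μ =
      ∫ ω in (W + Z) ⁻¹' A, Z ω ∂μ := by
  have := h.isProbabilityMeasure_map_input
  have hscore : Continuous (heatScore (μ.map W) t) := continuous_heatScore h.pos
  have hposterior : ∀ q : E × E, heatKernel t (q.2 - q.1) • (Prod.snd ⁻¹' A).indicator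
      (fun q => q.2 - q.1) q = A.indicator (fun y => -t • heatKernelGradient t (y - q.1)) q.2 := by
    intro q
    by_cases hq : q.2 ∈ A
    · simp [indicator, hq, heatKernelGradient, smul_smul, mul_div_cancel₀ _ h.pos.ne']
    · simp [indicator, hq]
  have hposterior_int : Integrable (fun q : E × E =>
      A.indicator (fun y => -t • heatKernelGradient t (y - q.1)) q.2) ((μ.map W).prod volume) :=
    (h.integrable_prod_heatKernelGradient.smul (-t)).indicator (measurable_snd hA)
  calc ∫ ω in (W + Z) ⁻¹' A, -t • heatScore (μ.map W) t ((W + Z) ω) ∂μ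
      = ∫ ω, A.indicator (fun y => -t • heatScore (μ.map W) t y) ((W + Z) ω) ∂μ :=
        (integral_indicator (h.measurable_add hA)).symm
    _ = ∫ y, A.indicator (fun y => -t • heatGradient (μ.map W) t y) y := by
        rw [h.integral_comp_add (φ := A.indicator fun y => -t • heatScore (μ.map W) t y)
          ((hscore.const_smul (-t)).stronglyMeasurable.indicator hA)]
        simp_rw [← indicator_smul_apply, smul_comm _ (-t), heatDensity_smul_heatScore h.pos]
    _ = ∫ y, ∫ w, A.indicator (fun y => -t • heatKernelGradient t (y - w)) y ∂(μ.map W) := by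
        refine integral_congr_ae (Filter.Eventually.of_forall fun y => ?_)
        by_cases hy : y ∈ A
        · simp [hy, heatGradient, integral_neg, integral_smul]
        · simp [hy]
    _ = ∫ ω, (Prod.snd ⁻¹' A).indicator (fun q => q.2 - q.1) (W ω, (W + Z) ω) ∂μ := by
        rw [h.integral_comp_prodMk (StronglyMeasurable.indicator (by fun_prop)
          (measurable_snd hA))]
        simp_rw [hposterior]
        exact (integral_prod_symm _ hposterior_int).symm
    _ = ∫ ω in (W + Z) ⁻¹' A, Z ω ∂μ := by
        rw [← integral_indicator (h.measurable_add hA)]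
        refine integral_congr_ae (Filter.Eventually.of_forall fun ω => ?_)
        by_cases hω : W ω + Z ω ∈ A <;> simp [indicator, hω]

/-- Tweedie's formula: since `∇ g_t z = -g_t z • z / t`, averaging the noise against the posterior
gives the score. -/
lemma condExp_noise (h : IsGaussianNoise W Z t μ) :
    μ[Z | MeasurableSpace.comap (W + Z) inferInstance] =ᵐ[μ]
      fun ω => -t • heatScore (μ.map W) t ((W + Z) ω) := by
  have := h.isProbabilityMeasure_map_input
  have hscore_int := h.integrable_heatScore_add.smul (-t)
  refine (ae_eq_condExp_of_forall_setIntegral_eq h.measurable_add.comap_le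
    (h.memLp_noise.integrable one_le_two) (fun s _ _ => hscore_int.integrableOn) ?_
    (((continuous_heatScore h.pos).const_smul (-t)).stronglyMeasurable.comp_measurable
      (comap_measurable (W + Z))).aestronglyMeasurable).symm
  rintro s ⟨A, hA, rfl⟩ -
  exact h.setIntegral_heatScore_add hA

lemma memLp_heatScore_add (h : IsGaussianNoise W Z t μ) :
    MemLp (fun ω => heatScore (μ.map W) t ((W + Z) ω)) 2 μ := by
  refine (((h.memLp_noise.condExp one_le_two).ae_eq h.condExp_noise).const_smul (-t)⁻¹).congr_norm
    h.integrable_heatScore_add.1 (Filter.Eventually.of_forall fun ω => ?_)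
  simp [inv_smul_smul₀ h.pos.ne']

lemma integral_norm_noise_sub_condExp_sq (h : IsGaussianNoise W Z t μ) :
    ∫ ω, ‖Z ω - (μ[Z | MeasurableSpace.comap (W + Z) inferInstance]) ω‖ ^ 2 ∂μ =
      Module.finrank ℝ E * t - t ^ 2 * ∫ ω, ‖heatScore (μ.map W) t ((W + Z) ω)‖ ^ 2 ∂μ := by
  have hcond : ∫ ω, ‖(μ[Z | MeasurableSpace.comap (W + Z) inferInstance]) ω‖ ^ 2 ∂μ =
      t ^ 2 * ∫ ω, ‖heatScore (μ.map W) t ((W + Z) ω)‖ ^ 2 ∂μ := by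
    rw [← integral_const_mul]
    refine integral_congr_ae ?_
    filter_upwards [h.condExp_noise] with ω hω
    rw [hω, norm_smul, mul_pow, norm_neg, Real.norm_eq_abs, sq_abs]
  have hpythagoras := integral_norm_sub_sq_eq_add_condExp h.measurable_add.comap_le h.memLp_noise
    MemLp.zero aestronglyMeasurable_zero
  simp only [Pi.zero_apply, sub_zero] at hpythagoras
  linarith [h.integral_norm_noise_sq]

lemma integral_norm_input_sub_condExp_sq (h : IsGaussianNoise W Z t μ) (hW : Integrable W μ) :
    ∫ ω, ‖W ω - (μ[W | MeasurableSpace.comap (W + Z) inferInstance]) ω‖ ^ 2 ∂μ =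
      ∫ ω, ‖Z ω - (μ[Z | MeasurableSpace.comap (W + Z) inferInstance]) ω‖ ^ 2 ∂μ := by
  refine integral_congr_ae ?_
  filter_upwards [sub_condExp_comap_add_ae_eq_neg hW (h.memLp_noise.integrable one_le_two)
    h.measurable_add] with ω hω
  simp only [Pi.sub_apply, Pi.neg_apply] at hω
  rw [hω, norm_neg]

lemma integral_norm_sub_add_sq (h : IsGaussianNoise W Z t μ) (hW : MemLp W 2 μ) (y : E) :
    ∫ ω, ‖y - (W + Z) ω‖ ^ 2 ∂μ = ∫ ω, ‖y - W ω‖ ^ 2 ∂μ + Module.finrank ℝ E * t := by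
  have hshift : MemLp (fun ω => y - W ω) 2 μ := (memLp_const y).sub hW
  have hcond : μ[Z | MeasurableSpace.comap W inferInstance] =ᵐ[μ] fun _ => 0 := by
    rw [← h.integral_noise]
    exact condExp_indep_eq h.measurable_noise.comap_le h.measurable_input.comap_le
      (comap_measurable Z).stronglyMeasurable h.indepFun.symm
  have hcross : ∫ ω, inner ℝ (y - W ω) (Z ω) ∂μ = 0 := by
    rw [← integral_inner_sub_condExp h.measurable_input.comap_le hshift
      ((stronglyMeasurable_const.sub (comap_measurable W).stronglyMeasurable).aestronglyMeasurable)
      h.memLp_noise]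
    refine integral_congr_ae ?_
    filter_upwards [hcond] with ω hω
    rw [hω, sub_zero]
  have hshift_sq := hshift.integrable_norm_pow two_ne_zero
  have hinner := (integrable_inner_of_memLp_two hshift h.memLp_noise).const_mul 2
  have hexpand : ∀ ω, ‖y - (W + Z) ω‖ ^ 2 =
      ‖y - W ω‖ ^ 2 - 2 * inner ℝ (y - W ω) (Z ω) + ‖Z ω‖ ^ 2 := fun ω => by
    rw [Pi.add_apply, ← sub_sub, norm_sub_sq_real]
  simp_rw [hexpand]
  rw [integral_add (by fun_prop) (h.memLp_noise.integrable_norm_pow two_ne_zero),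
    integral_sub hshift_sq hinner, integral_const_mul, hcross, h.integral_norm_noise_sq]
  ring

end IsGaussianNoise

end GaussianNoise

noncomputable section Entropy

variable {E : Type*} [NormedAddCommGroup E] [InnerProductSpace ℝ E] [FiniteDimensional ℝ E]
  [MeasurableSpace E] [BorelSpace E] {ν : Measure E} {t : ℝ} {u : E → ℝ} {u' : E → E}

lemma exists_isGaussianNoise_map_eq (ν : Measure E) [IsProbabilityMeasure ν] (ht : 0 < t) :
    ∃ P : Measure (E × E), IsProbabilityMeasure P ∧ P.map Prod.fst = ν ∧
      IsGaussianNoise (Prod.fst : E × E → E) Prod.snd t P := by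
  have := isProbabilityMeasure_withDensity_heatKernel (E := E) ht
  exact ⟨_, inferInstance, by simp, isGaussianNoise_fst_snd ht ν⟩

lemma integrable_prod_heatKernel_mul_one_add_norm_sq [IsProbabilityMeasure ν]
    (hν : MemLp id 2 ν) (ht : 0 < t) :
    Integrable (fun q : E × E => heatKernel t (q.2 - q.1) * (1 + ‖q.2‖ ^ 2))
      (ν.prod volume) := by
  obtain ⟨P, _, rfl, h⟩ := exists_isGaussianNoise_map_eq ν ht
  exact (h.integrable_comp_prodMk_iff (φ := fun q => 1 + ‖q.2‖ ^ 2) (by fun_prop)).1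
    ((integrable_const 1).add
      ((h.memLp_add (h.memLp_id_map_iff.1 hν)).integrable_norm_pow two_ne_zero))

lemma integrable_heatDensity_mul_one_add_norm_sq [IsProbabilityMeasure ν] (hν : MemLp id 2 ν)
    (ht : 0 < t) : Integrable fun y => heatDensity ν t y * (1 + ‖y‖ ^ 2) := by
  simpa only [integral_mul_const, heatDensity] using
    (integrable_prod_heatKernel_mul_one_add_norm_sq hν ht).integral_prod_right

lemma integrable_prod_sub_mul [IsProbabilityMeasure ν] (hν : MemLp id 2 ν) (ht : 0 < t)
    {c : E → ℝ} (hc : Continuous c) (hu : Continuous u) {K C : ℝ}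
    (hK : ∀ z, |c z| ≤ K * heatKernel t z) (hC : ∀ y, |u y| ≤ C * (1 + ‖y‖ ^ 2)) :
    Integrable (fun q : E × E => c (q.2 - q.1) * u q.2) (ν.prod volume) := by
  refine ((integrable_prod_heatKernel_mul_one_add_norm_sq hν ht).const_mul (K * C)).mono'
    (by fun_prop) (Filter.Eventually.of_forall fun q => ?_)
  calc ‖c (q.2 - q.1) * u q.2‖ = |c (q.2 - q.1)| * |u q.2| := abs_mul _ _
    _ ≤ K * heatKernel t (q.2 - q.1) * (C * (1 + ‖q.2‖ ^ 2)) :=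
        mul_le_mul (hK _) (hC _) (abs_nonneg _) ((abs_nonneg _).trans (hK _))
    _ = K * C * (heatKernel t (q.2 - q.1) * (1 + ‖q.2‖ ^ 2)) := by ring

lemma integral_heatKernelDeriv_sub_mul (ht : 0 < t) (w : E)
    (hu : ∀ y, HasGradientAt u (u' y) y)
    (hu_int : Integrable fun y => (1 + ‖y - w‖ ^ 2) * heatKernel t (y - w) * u y)
    (hu'_int : Integrable fun y => heatKernel t (y - w) * ‖u' y‖ ^ 2) :
    ∫ y, heatKernelDeriv t (y - w) * u y =
      -(1 / 2) * ∫ y, inner ℝ (heatKernelGradient t (y - w)) (u' y) := by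
  have hshift : ∀ z, HasGradientAt (fun z => u (z + w)) (u' (z + w)) z := fun z =>
    hasGradientAt_iff_hasFDerivAt.2 ((hasFDerivAt_comp_add_right w).2 (hu (z + w)).hasFDerivAt)
  rw [← integral_add_right_eq_self _ w,
    ← integral_add_right_eq_self (fun y => inner ℝ (heatKernelGradient t (y - w)) (u' y)) w]
  simp only [add_sub_cancel_right]
  exact integral_heatKernelDeriv_mul ht hshift (by simpa using hu_int.comp_add_right w)
    (by simpa using hu'_int.comp_add_right w)

lemma integrable_prod_heatKernel_mul_norm_sq [IsProbabilityMeasure ν] (ht : 0 < t)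
    (hu' : Measurable u') (hu'_int : Integrable fun y => heatDensity ν t y * ‖u' y‖ ^ 2) :
    Integrable (fun q : E × E => heatKernel t (q.2 - q.1) * ‖u' q.2‖ ^ 2) (ν.prod volume) := by
  obtain ⟨P, _, rfl, h⟩ := exists_isGaussianNoise_map_eq ν ht
  exact (h.integrable_comp_prodMk_iff (φ := fun q => ‖u' q.2‖ ^ 2)
    (by fun_prop : Measurable _).stronglyMeasurable).1 ((h.integrable_comp_add_iff
      (φ := fun y => ‖u' y‖ ^ 2) (by fun_prop : Measurable _).stronglyMeasurable).2 hu'_int)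

lemma integrable_prod_inner_heatKernelGradient [IsProbabilityMeasure ν] (ht : 0 < t)
    (hu' : Measurable u') (hu'_int : Integrable fun y => heatDensity ν t y * ‖u' y‖ ^ 2) :
    Integrable (fun q : E × E => inner ℝ (heatKernelGradient t (q.2 - q.1)) (u' q.2))
      (ν.prod volume) := by
  obtain ⟨P, _, rfl, h⟩ := exists_isGaussianNoise_map_eq ν ht
  have hu'_memLp : MemLp (fun ω => u' ((Prod.fst + Prod.snd : E × E → E) ω)) 2 P :=
    (memLp_two_iff_integrable_sq_norm (hu'.comp h.measurable_add).aestronglyMeasurable).2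
      ((h.integrable_comp_add_iff (φ := fun y => ‖u' y‖ ^ 2)
        (by fun_prop : Measurable _).stronglyMeasurable).2 hu'_int)
  have hinner := (h.integrable_comp_prodMk_iff (φ := fun q => inner ℝ (q.2 - q.1) (u' q.2))
    (by fun_prop : Measurable _).stronglyMeasurable).1
    (by simpa using integrable_inner_of_memLp_two h.memLp_noise hu'_memLp)
  refine (hinner.const_mul (-t⁻¹)).congr (Filter.Eventually.of_forall fun q => ?_)
  simp only [heatKernelGradient, inner_smul_left, smul_eq_mul, conj_trivial]
  ring

/-- The heat equation `∂ₜ p = Δ p / 2` of the flow in weak form. -/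
lemma integral_heatDensityDeriv_mul [IsProbabilityMeasure ν] (hν : MemLp id 2 ν) (ht : 0 < t)
    (hu : ∀ y, HasGradientAt u (u' y) y) {C : ℝ} (hC : ∀ y, |u y| ≤ C * (1 + ‖y‖ ^ 2))
    (hu'_int : Integrable fun y => heatDensity ν t y * ‖u' y‖ ^ 2) :
    ∫ y, heatDensityDeriv ν t y * u y =
      -(1 / 2) * ∫ y, inner ℝ (heatGradient ν t y) (u' y) := by
  have hu_cont : Continuous u := continuous_iff_continuousAt.2 fun y => (hu y).continuousAt
  have hu'_meas := measurable_of_hasGradientAt hu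
  obtain ⟨K, hK⟩ := exists_abs_heatKernelDeriv_le (E := E) ht le_rfl
  obtain ⟨L, -, hL⟩ := exists_one_add_norm_sq_mul_heatKernel_le (E := E) ht le_rfl
  have hderiv_int : Integrable (fun q : E × E => heatKernelDeriv t (q.2 - q.1) * u q.2)
      (ν.prod volume) := integrable_prod_sub_mul hν (by positivity : 0 < 2 * t) (by fun_prop)
    hu_cont (hK t (left_mem_Icc.2 le_rfl)) hC
  have hu_int : Integrable (fun q : E × E =>
      (1 + ‖q.2 - q.1‖ ^ 2) * heatKernel t (q.2 - q.1) * u q.2) (ν.prod volume) :=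
    integrable_prod_sub_mul (c := fun z => (1 + ‖z‖ ^ 2) * heatKernel t z) hν
      (by positivity : 0 < 2 * t) (by fun_prop) hu_cont (fun z => by
        have := heatKernel_pos ht z
        rw [abs_of_nonneg (by positivity)]
        exact hL t (left_mem_Icc.2 le_rfl) z) hC
  have hinner_int := integrable_prod_inner_heatKernelGradient ht hu'_meas hu'_int
  calc ∫ y, heatDensityDeriv ν t y * u y
      = ∫ y, ∫ w, heatKernelDeriv t (y - w) * u y ∂ν := by
        simp_rw [integral_mul_const, heatDensityDeriv]
    _ = ∫ w, (∫ y, heatKernelDeriv t (y - w) * u y) ∂ν :=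
        (integral_integral_swap (f := fun w y => heatKernelDeriv t (y - w) * u y) hderiv_int).symm
    _ = ∫ w, -(1 / 2) * (∫ y, inner ℝ (heatKernelGradient t (y - w)) (u' y)) ∂ν := by
        refine integral_congr_ae ?_
        filter_upwards [hu_int.prod_right_ae,
          (integrable_prod_heatKernel_mul_norm_sq ht hu'_meas hu'_int).prod_right_ae]
          with w hw hw'
        exact integral_heatKernelDeriv_sub_mul ht w hu hw hw'
    _ = -(1 / 2) * ∫ y, ∫ w, inner ℝ (heatKernelGradient t (y - w)) (u' y) ∂ν := by
        rw [integral_const_mul, integral_integral_swap hinner_int]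
    _ = -(1 / 2) * ∫ y, inner ℝ (heatGradient ν t y) (u' y) := by
        simp_rw [real_inner_comm (u' _), heatGradient,
          integral_inner (integrable_heatKernelGradient_sub ht _)]

/-- The differential entropy of the law with density `heatDensity ν t`. -/
def heatEntropy (ν : Measure E) (t : ℝ) : ℝ :=
  ∫ y, Real.negMulLog (heatDensity ν t y)

/-- The Fisher information of the law with density `heatDensity ν t`. -/
def heatFisherInfo (ν : Measure E) (t : ℝ) : ℝ :=
  ∫ y, heatDensity ν t y * ‖heatScore ν t y‖ ^ 2

lemma integrable_heatDensity_mul_norm_heatScore_sq [IsProbabilityMeasure ν] (ht : 0 < t) :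
    Integrable fun y => heatDensity ν t y * ‖heatScore ν t y‖ ^ 2 := by
  obtain ⟨P, _, rfl, h⟩ := exists_isGaussianNoise_map_eq ν ht
  have := continuous_heatScore (ν := P.map Prod.fst) ht
  exact (h.integrable_comp_add_iff (φ := fun y => ‖heatScore (P.map Prod.fst) t y‖ ^ 2)
    (by fun_prop)).1 (h.memLp_heatScore_add.integrable_norm_pow two_ne_zero)

lemma exists_abs_log_heatDensity_add_one_le [IsProbabilityMeasure ν] (hν : MemLp id 2 ν)
    {a b : ℝ} (ha : 0 < a) :
    ∃ C : ℝ, ∀ t ∈ Icc a b, ∀ y, |Real.log (heatDensity ν t y) + 1| ≤ C * (1 + ‖y‖ ^ 2) := by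
  obtain ⟨C, hC⟩ := exists_abs_log_heatDensity_le (b := b) hν ha
  refine ⟨C + 1, fun t ht y => (abs_add_le _ _).trans ?_⟩
  rw [abs_one]
  linarith [hC t ht y, sq_nonneg ‖y‖]

lemma integral_heatDensityDeriv_mul_log_add_one [IsProbabilityMeasure ν] (hν : MemLp id 2 ν)
    (ht : 0 < t) :
    ∫ y, heatDensityDeriv ν t y * (Real.log (heatDensity ν t y) + 1) =
      -(1 / 2) * heatFisherInfo ν t := by
  obtain ⟨C, hC⟩ := exists_abs_log_heatDensity_add_one_le (b := t) hν ht
  rw [integral_heatDensityDeriv_mul hν ht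
    (fun y => hasGradientAt_iff_hasFDerivAt.2
      ((hasGradientAt_log_heatDensity ht y).hasFDerivAt.add_const 1))
    (hC t (right_mem_Icc.2 le_rfl)) (integrable_heatDensity_mul_norm_heatScore_sq ht),
    heatFisherInfo]
  simp_rw [← heatDensity_smul_heatScore ht, real_inner_smul_left, real_inner_self_eq_norm_sq]

lemma integrable_negMulLog_heatDensity [IsProbabilityMeasure ν] (hν : MemLp id 2 ν)
    (ht : 0 < t) : Integrable fun y => Real.negMulLog (heatDensity ν t y) := by
  obtain ⟨C, hC⟩ := exists_abs_log_heatDensity_le (b := t) hν ht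
  have := continuous_heatDensity (ν := ν) ht
  refine ((integrable_heatDensity_mul_one_add_norm_sq hν ht).const_mul C).mono'
    (by fun_prop) (Filter.Eventually.of_forall fun y => ?_)
  have hp := heatDensity_pos (ν := ν) ht y
  calc ‖Real.negMulLog (heatDensity ν t y)‖
      = heatDensity ν t y * |Real.log (heatDensity ν t y)| := by
        rw [Real.negMulLog, norm_mul, norm_neg, Real.norm_of_nonneg hp.le, Real.norm_eq_abs]
    _ ≤ heatDensity ν t y * (C * (1 + ‖y‖ ^ 2)) := by
        gcongr
        exact hC t (right_mem_Icc.2 le_rfl) y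
    _ = C * (heatDensity ν t y * (1 + ‖y‖ ^ 2)) := by ring

lemma stronglyMeasurable_heatDensityDeriv [SFinite ν] (t : ℝ) :
    StronglyMeasurable (heatDensityDeriv ν t) :=
  StronglyMeasurable.integral_prod_right (f := fun y w => heatKernelDeriv t (y - w))
    ((continuous_heatKernelDeriv t).comp (continuous_fst.sub continuous_snd)).stronglyMeasurable

lemma exists_abs_heatDensityDeriv_mul_log_add_one_le [IsProbabilityMeasure ν]
    (hν : MemLp id 2 ν) {a b : ℝ} (ha : 0 < a) (hab : a ≤ b) :
    ∃ C : ℝ, ∀ t ∈ Icc a b, ∀ y,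
      |heatDensityDeriv ν t y * (Real.log (heatDensity ν t y) + 1)| ≤
        C * (heatDensity ν (2 * b) y * (1 + ‖y‖ ^ 2)) := by
  obtain ⟨C, hC⟩ := exists_abs_log_heatDensity_add_one_le (b := b) hν ha
  obtain ⟨K, hK⟩ := exists_abs_heatDensityDeriv_le ν ha hab
  refine ⟨K * C, fun t ht y => ?_⟩
  calc |heatDensityDeriv ν t y * (Real.log (heatDensity ν t y) + 1)|
      = |heatDensityDeriv ν t y| * |Real.log (heatDensity ν t y) + 1| := abs_mul _ _
    _ ≤ K * heatDensity ν (2 * b) y * (C * (1 + ‖y‖ ^ 2)) :=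
        mul_le_mul (hK t ht y) (hC t ht y) (abs_nonneg _) ((abs_nonneg _).trans (hK t ht y))
    _ = K * C * (heatDensity ν (2 * b) y * (1 + ‖y‖ ^ 2)) := by ring

lemma hasDerivAt_negMulLog_heatDensity [IsFiniteMeasure ν] [NeZero ν] (ht : 0 < t) (y : E) :
    HasDerivAt (fun s => Real.negMulLog (heatDensity ν s y))
      (-(heatDensityDeriv ν t y * (Real.log (heatDensity ν t y) + 1))) t :=
  (HasDerivAt.comp (h₂ := Real.negMulLog) t
    (Real.hasDerivAt_negMulLog (heatDensity_pos ht y).ne')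
    (hasDerivAt_heatDensity ht y)).congr_deriv (by ring)

/-- De Bruijn's identity. -/
lemma hasDerivAt_heatEntropy [IsProbabilityMeasure ν] (hν : MemLp id 2 ν) (ht : 0 < t) :
    HasDerivAt (heatEntropy ν) (heatFisherInfo ν t / 2) t := by
  obtain ⟨C, hC⟩ := exists_abs_heatDensityDeriv_mul_log_add_one_le hν (half_pos ht)
    (by linarith : t / 2 ≤ 2 * t)
  have hnhds : Icc (t / 2) (2 * t) ∈ nhds t := Icc_mem_nhds (by linarith) (by linarith)
  have hpos : ∀ s ∈ Icc (t / 2) (2 * t), 0 < s := fun s hs => (half_pos ht).trans_le hs.1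
  have hderiv : HasDerivAt (heatEntropy ν)
      (∫ y, -(heatDensityDeriv ν t y * (Real.log (heatDensity ν t y) + 1))) t := by
    refine (hasDerivAt_integral_of_dominated_loc_of_deriv_le (μ := volume)
      (F := fun s y => Real.negMulLog (heatDensity ν s y))
      (F' := fun s y => -(heatDensityDeriv ν s y * (Real.log (heatDensity ν s y) + 1)))
      (bound := fun y => C * (heatDensity ν (2 * (2 * t)) y * (1 + ‖y‖ ^ 2))) hnhds
      ?_ (integrable_negMulLog_heatDensity hν ht) ?_ ?_
      ((integrable_heatDensity_mul_one_add_norm_sq hν (by positivity)).const_mul C) ?_).2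
    · filter_upwards [hnhds] with s hs
      exact (integrable_negMulLog_heatDensity hν (hpos s hs)).aestronglyMeasurable
    · exact ((stronglyMeasurable_heatDensityDeriv t).mul
        ((continuous_log_heatDensity ht).add continuous_const).stronglyMeasurable).neg
          |>.aestronglyMeasurable
    · refine Filter.Eventually.of_forall fun y s hs => ?_
      rw [norm_neg]
      exact hC s hs y
    · exact Filter.Eventually.of_forall fun y s hs =>
        hasDerivAt_negMulLog_heatDensity (hpos s hs) y
  refine hderiv.congr_deriv ?_
  rw [integral_neg, integral_heatDensityDeriv_mul_log_add_one hν ht]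
  ring

/-- The entropy of the heat flow in excess of that of the heat kernel. This is the mutual
information between the input and the output of the Gaussian channel. -/
def heatEntropyGain (ν : Measure E) (t : ℝ) : ℝ :=
  heatEntropy ν t - Module.finrank ℝ E / 2 * (Real.log (2 * Real.pi * t) + 1)

lemma hasDerivAt_heatEntropyGain [IsProbabilityMeasure ν] (hν : MemLp id 2 ν) (ht : 0 < t) :
    HasDerivAt (heatEntropyGain ν)
      (-(1 / 2) * (Module.finrank ℝ E / t - heatFisherInfo ν t)) t := by
  have hlog : HasDerivAt (fun s : ℝ => Real.log (2 * Real.pi * s))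
      (2 * Real.pi / (2 * Real.pi * t)) t :=
    (hasDerivAt_const_mul (2 * Real.pi)).log (by positivity)
  refine ((hasDerivAt_heatEntropy hν ht).sub
    ((hlog.add_const 1).const_mul (Module.finrank ℝ E / 2 : ℝ))).congr_deriv ?_
  field_simp
  ring

namespace IsGaussianNoise

variable {Ω α : Type*} [MeasurableSpace Ω] [MeasurableSpace α] {μ : Measure Ω}
  [IsProbabilityMeasure μ] {U : Ω → α} {f : α → E} {W Z : Ω → E}

lemma integral_norm_heatScore_add_sq (h : IsGaussianNoise W Z t μ) :
    ∫ ω, ‖heatScore (μ.map W) t ((W + Z) ω)‖ ^ 2 ∂μ = heatFisherInfo (μ.map W) t := by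
  have := h.isProbabilityMeasure_map_input
  have := continuous_heatScore (ν := μ.map W) h.pos
  exact h.integral_comp_add (φ := fun y => ‖heatScore (μ.map W) t y‖ ^ 2) (by fun_prop)

lemma finrank_div_sub_heatFisherInfo (h : IsGaussianNoise W Z t μ) :
    Module.finrank ℝ E / t - heatFisherInfo (μ.map W) t =
      (∫ ω, ‖Z ω - (μ[Z | MeasurableSpace.comap (W + Z) inferInstance]) ω‖ ^ 2 ∂μ) / t ^ 2 := by
  have ht := h.pos
  rw [h.integral_norm_noise_sub_condExp_sq, h.integral_norm_heatScore_add_sq]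
  field_simp

lemma map_prodMk_comp_add_eq_prod_withDensity (h : IsGaussianNoise U Z t μ) (hf : Measurable f) :
    μ.map (fun ω => (U ω, (f ∘ U + Z) ω)) =
      ((μ.map U).prod (μ.map (f ∘ U + Z))).withDensity fun q =>
        ENNReal.ofReal (heatKernel t (q.2 - f q.1) / heatDensity (μ.map (f ∘ U)) t q.2) := by
  have hfU := h.comp hf
  have := hfU.isProbabilityMeasure_map_input
  have := (continuous_heatDensity (ν := μ.map (f ∘ U)) h.pos).measurable
  rw [h.map_prodMk_comp_add hf, hfU.map_add, prod_withDensity_right (by fun_prop),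
    ← withDensity_mul _ (by fun_prop) (by fun_prop)]
  congr 1
  ext1 q
  have hp := heatDensity_pos (ν := μ.map (f ∘ U)) h.pos q.2
  rw [Pi.mul_apply, ← ENNReal.ofReal_mul hp.le, mul_div_cancel₀ _ hp.ne']

lemma map_prodMk_add_eq_prod_withDensity (h : IsGaussianNoise W Z t μ) :
    μ.map (fun ω => (W ω, (W + Z) ω)) = ((μ.map W).prod (μ.map (W + Z))).withDensity fun q =>
      ENNReal.ofReal (heatKernel t (q.2 - q.1) / heatDensity (μ.map W) t q.2) :=
  h.map_prodMk_comp_add_eq_prod_withDensity measurable_id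

/-- The likelihood ratio depends on the input only through its image. -/
lemma mutualInfo_comp_add (h : IsGaussianNoise U Z t μ) (hf : Measurable f) :
    mutualInfo U (f ∘ U + Z) μ = mutualInfo (f ∘ U) (f ∘ U + Z) μ := by
  have hU := h.measurable_input
  have hY : Measurable (f ∘ U + Z) := (h.comp hf).measurable_add
  have := h.isProbabilityMeasure_map_input
  have := (h.comp hf).isProbabilityMeasure_map_input
  have := Measure.isProbabilityMeasure_map (μ := μ) hY.aemeasurable
  have := Measure.isProbabilityMeasure_map (μ := μ) (hU.prodMk hY).aemeasurable
  let ρ : E × E → ENNReal := fun q =>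
    ENNReal.ofReal (heatKernel t (q.2 - q.1) / heatDensity (μ.map (f ∘ U)) t q.2)
  have hρ : Measurable ρ := by
    have := (continuous_heatDensity (ν := μ.map (f ∘ U)) h.pos).measurable
    fun_prop
  have hjoint : μ.map (fun ω => (U ω, (f ∘ U + Z) ω)) =
      ((μ.map U).prod (μ.map (f ∘ U + Z))).withDensity (ρ ∘ Prod.map f id) :=
    h.map_prodMk_comp_add_eq_prod_withDensity hf
  have hφ : Measurable (Prod.map f id : α × E → E × E) := hf.prodMap measurable_id
  have hmarginals : (μ.map (f ∘ U)).prod (μ.map (f ∘ U + Z)) =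
      ((μ.map U).prod (μ.map (f ∘ U + Z))).map (Prod.map f id) := by
    rw [← Measure.map_prod_map _ _ hf measurable_id, Measure.map_id, Measure.map_map hf hU]
  have himage : μ.map (fun ω => ((f ∘ U) ω, (f ∘ U + Z) ω)) =
      (μ.map fun ω => (U ω, (f ∘ U + Z) ω)).map (Prod.map f id) := by
    rw [Measure.map_map hφ (hU.prodMk hY)]
    rfl
  have hfinite : IsFiniteMeasure
      (((μ.map U).prod (μ.map (f ∘ U + Z))).withDensity (ρ ∘ Prod.map f id)) :=
    hjoint ▸ inferInstance
  rw [mutualInfo, mutualInfo, himage, hmarginals, hjoint]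
  exact (klDiv_map_withDensity_comp hφ hρ).symm

lemma llr_map_prodMk_add (h : IsGaussianNoise W Z t μ) :
    (fun ω => llr (μ.map fun ω => (W ω, (W + Z) ω)) ((μ.map W).prod (μ.map (W + Z)))
      (W ω, (W + Z) ω)) =ᵐ[μ]
      fun ω => Real.log (heatKernel t (Z ω)) - Real.log (heatDensity (μ.map W) t ((W + Z) ω)) := by
  have hWY : Measurable fun ω => (W ω, (W + Z) ω) := h.measurable_input.prodMk h.measurable_add
  have := h.isProbabilityMeasure_map_input
  have := Measure.isProbabilityMeasure_map (μ := μ) h.measurable_add.aemeasurable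
  have := (continuous_heatDensity (ν := μ.map W) h.pos).measurable
  have hjoint := h.map_prodMk_add_eq_prod_withDensity
  have hac : μ.map (fun ω => (W ω, (W + Z) ω)) ≪ (μ.map W).prod (μ.map (W + Z)) :=
    hjoint ▸ withDensity_absolutelyContinuous _ _
  have hrnDeriv := ae_of_ae_map hWY.aemeasurable (hac.ae_le (Measure.rnDeriv_withDensity
    ((μ.map W).prod (μ.map (W + Z))) (f := fun q =>
      ENNReal.ofReal (heatKernel t (q.2 - q.1) / heatDensity (μ.map W) t q.2)) (by fun_prop)))
  rw [← hjoint] at hrnDeriv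
  filter_upwards [hrnDeriv] with ω hω
  have hk := heatKernel_pos h.pos (Z ω)
  have hp := heatDensity_pos (ν := μ.map W) h.pos ((W + Z) ω)
  simp only [llr_def]
  rw [hω, show (W + Z) ω - W ω = Z ω from add_sub_cancel_left _ _,
    ENNReal.toReal_ofReal (by positivity), Real.log_div hk.ne' hp.ne']

lemma integrable_log_heatKernel_noise (h : IsGaussianNoise U Z t μ) :
    Integrable (fun ω => Real.log (heatKernel t (Z ω))) μ := by
  simp_rw [log_heatKernel h.pos]
  exact (integrable_const _).sub ((h.memLp_noise.integrable_norm_pow two_ne_zero).div_const _)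

lemma integral_log_heatKernel_noise (h : IsGaussianNoise U Z t μ) :
    ∫ ω, Real.log (heatKernel t (Z ω)) ∂μ =
      -(Module.finrank ℝ E / 2 * (Real.log (2 * Real.pi * t) + 1)) := by
  have ht := h.pos
  simp_rw [log_heatKernel ht]
  rw [integral_sub (integrable_const _)
    ((h.memLp_noise.integrable_norm_pow two_ne_zero).div_const _), integral_div,
    h.integral_norm_noise_sq]
  simp only [integral_const, probReal_univ, one_smul]
  field_simp
  ring

lemma integrable_log_heatDensity_add (h : IsGaussianNoise W Z t μ) (hW : MemLp W 2 μ) :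
    Integrable (fun ω => Real.log (heatDensity (μ.map W) t ((W + Z) ω))) μ := by
  have := h.isProbabilityMeasure_map_input
  rw [h.integrable_comp_add_iff (continuous_log_heatDensity h.pos).stronglyMeasurable]
  refine (integrable_negMulLog_heatDensity (h.memLp_id_map_iff.2 hW) h.pos).neg.congr
    (Filter.Eventually.of_forall fun y => ?_)
  simp [Real.negMulLog]

lemma integral_log_heatDensity_add (h : IsGaussianNoise W Z t μ) :
    ∫ ω, Real.log (heatDensity (μ.map W) t ((W + Z) ω)) ∂μ = -heatEntropy (μ.map W) t := by
  have := h.isProbabilityMeasure_map_input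
  rw [h.integral_comp_add (continuous_log_heatDensity h.pos).stronglyMeasurable, heatEntropy,
    ← integral_neg]
  simp [Real.negMulLog]

lemma mutualInfo_add_ne_top (h : IsGaussianNoise W Z t μ) (hW : MemLp W 2 μ) :
    mutualInfo W (W + Z) μ ≠ ⊤ := by
  have hWY : Measurable fun ω => (W ω, (W + Z) ω) := h.measurable_input.prodMk h.measurable_add
  refine klDiv_ne_top (h.map_prodMk_add_eq_prod_withDensity ▸
    withDensity_absolutelyContinuous _ _) ?_
  rw [integrable_map_measure (stronglyMeasurable_llr _ _).aestronglyMeasurable hWY.aemeasurable]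
  exact (h.integrable_log_heatKernel_noise.sub (h.integrable_log_heatDensity_add hW)).congr
    h.llr_map_prodMk_add.symm

lemma toReal_mutualInfo_add (h : IsGaussianNoise W Z t μ) (hW : MemLp W 2 μ) :
    (mutualInfo W (W + Z) μ).toReal = heatEntropyGain (μ.map W) t := by
  have hWY : Measurable fun ω => (W ω, (W + Z) ω) := h.measurable_input.prodMk h.measurable_add
  have := h.isProbabilityMeasure_map_input
  have := Measure.isProbabilityMeasure_map (μ := μ) h.measurable_add.aemeasurable
  have := Measure.isProbabilityMeasure_map (μ := μ) hWY.aemeasurable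
  rw [mutualInfo, toReal_klDiv_of_measure_eq (h.map_prodMk_add_eq_prod_withDensity ▸
      withDensity_absolutelyContinuous _ _) (by simp),
    integral_map hWY.aemeasurable (stronglyMeasurable_llr _ _).aestronglyMeasurable,
    integral_congr_ae h.llr_map_prodMk_add, integral_sub h.integrable_log_heatKernel_noise
      (h.integrable_log_heatDensity_add hW), h.integral_log_heatKernel_noise,
    h.integral_log_heatDensity_add, heatEntropyGain]
  ring

end IsGaussianNoise

lemma heatFisherInfo_le [IsProbabilityMeasure ν] (ht : 0 < t) :
    heatFisherInfo ν t ≤ Module.finrank ℝ E / t := by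
  obtain ⟨P, _, rfl, h⟩ := exists_isGaussianNoise_map_eq ν ht
  rw [← sub_nonneg, h.finrank_div_sub_heatFisherInfo]
  positivity

lemma heatEntropyGain_nonneg [IsProbabilityMeasure ν] (hν : MemLp id 2 ν) (ht : 0 < t) :
    0 ≤ heatEntropyGain ν t := by
  obtain ⟨P, _, rfl, h⟩ := exists_isGaussianNoise_map_eq ν ht
  rw [← h.toReal_mutualInfo_add (h.memLp_id_map_iff.1 hν)]
  exact ENNReal.toReal_nonneg

lemma heatEntropyGain_le [IsProbabilityMeasure ν] (hν : MemLp id 2 ν) (ht : 0 < t) :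
    heatEntropyGain ν t ≤ (∫ w, ‖(∫ w, w ∂ν) - w‖ ^ 2 ∂ν) / t := by
  set m := ∫ w, w ∂ν
  set V := ∫ w, ‖m - w‖ ^ 2 ∂ν with hV
  set L := Module.finrank ℝ E / 2 * Real.log (2 * Real.pi * t)
  have hlog : ∀ y, -Real.log (heatDensity ν t y) ≤ L + (‖m - y‖ ^ 2 + V) / (2 * t) := fun y => by
    have hy := abs_log_heatDensity_add_le hν ht y
    rw [integral_norm_sub_sq_eq_norm_sub_integral_sq_add (X := fun w => w) hν y,
      norm_sub_rev y] at hy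
    linarith [neg_abs_le (Real.log (heatDensity ν t y) + L)]
  obtain ⟨P, _, hP, h⟩ := exists_isGaussianNoise_map_eq ν ht
  have hfst : MemLp Prod.fst 2 P := h.memLp_id_map_iff.1 (hP ▸ hν)
  have hsq : Integrable (fun ω => ‖m - (Prod.fst + Prod.snd : E × E → E) ω‖ ^ 2) P :=
    ((memLp_const m).sub (h.memLp_add hfst)).integrable_norm_pow two_ne_zero
  have hvar : ∫ ω, ‖m - ω.1‖ ^ 2 ∂P = V := by
    rw [hV, ← hP, integral_map measurable_fst.aemeasurable (by fun_prop)]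
  have hentropy : heatEntropy ν t ≤ L + (V + Module.finrank ℝ E * t + V) / (2 * t) :=
    calc heatEntropy ν t
        = ∫ ω, -Real.log (heatDensity ν t ((Prod.fst + Prod.snd : E × E → E) ω)) ∂P := by
          rw [integral_neg, ← hP, h.integral_log_heatDensity_add, neg_neg]
      _ ≤ ∫ ω, (L + (‖m - (Prod.fst + Prod.snd : E × E → E) ω‖ ^ 2 + V) / (2 * t)) ∂P := by
          refine integral_mono ?_ (by fun_prop) fun ω => hlog _
          rw [← hP]
          exact (h.integrable_log_heatDensity_add hfst).neg
      _ = L + (V + Module.finrank ℝ E * t + V) / (2 * t) := by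
          rw [integral_add (integrable_const _) (by fun_prop), integral_div,
            integral_add hsq (integrable_const _), h.integral_norm_sub_add_sq hfst, hvar]
          simp only [integral_const, probReal_univ, one_smul]
  calc heatEntropyGain ν t
      ≤ L + (V + Module.finrank ℝ E * t + V) / (2 * t) -
          Module.finrank ℝ E / 2 * (Real.log (2 * Real.pi * t) + 1) :=
        sub_le_sub_right hentropy _
    _ = V / t := by
        simp only [L]
        field_simp
        ring

lemma tendsto_heatEntropyGain_atTop [IsProbabilityMeasure ν] (hν : MemLp id 2 ν) :
    Filter.Tendsto (heatEntropyGain ν) Filter.atTop (nhds 0) := by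
  have hbound : Filter.Tendsto (fun t : ℝ => (∫ w, ‖(∫ w, w ∂ν) - w‖ ^ 2 ∂ν) / t)
      Filter.atTop (nhds 0) := tendsto_const_nhds.div_atTop Filter.tendsto_id
  refine tendsto_of_tendsto_of_tendsto_of_le_of_le' tendsto_const_nhds hbound ?_ ?_
  · filter_upwards [Filter.eventually_gt_atTop 0] with t ht
    exact heatEntropyGain_nonneg hν ht
  · filter_upwards [Filter.eventually_gt_atTop 0] with t ht
    exact heatEntropyGain_le hν ht

lemma integrableOn_Ioi_finrank_div_sub_heatFisherInfo [IsProbabilityMeasure ν]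
    (hν : MemLp id 2 ν) (ht : 0 < t) :
    IntegrableOn (fun s => Module.finrank ℝ E / s - heatFisherInfo ν s) (Ioi t) := by
  have hderiv := integrableOn_Ioi_deriv_of_nonpos'
    (fun s hs => hasDerivAt_heatEntropyGain hν (ht.trans_le hs))
    (fun s hs => mul_nonpos_of_nonpos_of_nonneg (by norm_num)
      (sub_nonneg.2 (heatFisherInfo_le (ht.trans hs))))
    (tendsto_heatEntropyGain_atTop hν)
  exact (integrable_const_mul_iff (by norm_num : IsUnit (-(1 / 2) : ℝ)) _).1 hderiv

lemma heatEntropyGain_eq_integral_Ioi [IsProbabilityMeasure ν] (hν : MemLp id 2 ν) (ht : 0 < t) :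
    heatEntropyGain ν t =
      1 / 2 * ∫ s in Ioi t, (Module.finrank ℝ E / s - heatFisherInfo ν s) := by
  have hftc := integral_Ioi_of_hasDerivAt_of_nonpos'
    (fun s hs => hasDerivAt_heatEntropyGain hν (ht.trans_le hs))
    (fun s hs => mul_nonpos_of_nonpos_of_nonneg (by norm_num)
      (sub_nonneg.2 (heatFisherInfo_le (ht.trans hs))))
    (tendsto_heatEntropyGain_atTop hν)
  rw [integral_const_mul] at hftc
  linarith

end Entropy

section Density

variable {n : ℕ} {ν : Measure (EuclideanSpace ℝ (Fin n))} {p q : EuclideanSpace ℝ (Fin n) → ℝ}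

lemma IsC1Density.unique (hp : IsC1Density ν p) (hq : IsC1Density ν q) : p = q := by
  have hp_cont := hp.contDiff.continuous
  have hq_cont := hq.contDiff.continuous
  have hae := hp.eq_withDensity.symm.trans hq.eq_withDensity
  rw [withDensity_eq_iff_of_sigmaFinite (by fun_prop) (by fun_prop)] at hae
  rw [← hp_cont.ae_eq_iff_eq volume hq_cont]
  filter_upwards [hae] with y hy
  exact (ENNReal.ofReal_eq_ofReal_iff (hp.nonneg y) (hq.nonneg y)).1 hy

lemma IsC1Density.density_eq (hp : IsC1Density ν p) : density ν = p := by
  have hex : ∃ p, IsC1Density ν p := ⟨p, hp⟩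
  rw [density, dif_pos hex]
  exact hex.choose_spec.unique hp

end Density

section Channel

variable {Ω : Type*} [MeasurableSpace Ω] {μ : Measure Ω} [IsProbabilityMeasure μ] {n : ℕ} {t : ℝ}
  {W Z : Ω → EuclideanSpace ℝ (Fin n)}

lemma trace_covMat (hW : MemLp W 2 μ) :
    (covMat W μ).trace = ∫ ω, ‖W ω - ∫ ω, W ω ∂μ‖ ^ 2 ∂μ := by
  have hcoord : ∀ i, Integrable (fun ω => (W ω i - (∫ ω, W ω ∂μ) i) ^ 2) μ := fun i =>
    ((hW.sub (memLp_const (∫ ω, W ω ∂μ))).eval_piLp i).integrable_sq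
  simp_rw [EuclideanSpace.real_norm_sq_eq, PiLp.sub_apply]
  rw [integral_finsetSum _ fun i _ => hcoord i]
  simp_rw [Matrix.trace, Matrix.diag_apply, covMat, Matrix.of_apply, covariance, ← sq,
    eval_integral_piLp fun i => (hW.eval_piLp i).integrable one_le_two]

namespace IsGaussianNoise

lemma isC1Density_map_add (h : IsGaussianNoise W Z t μ) :
    IsC1Density (μ.map (W + Z)) (heatDensity (μ.map W) t) :=
  have := h.isProbabilityMeasure_map_input
  ⟨contDiff_heatDensity h.pos, fun y => (heatDensity_pos h.pos y).le, h.map_add⟩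

lemma density_map_add (h : IsGaussianNoise W Z t μ) :
    density (μ.map (W + Z)) = heatDensity (μ.map W) t :=
  h.isC1Density_map_add.density_eq

lemma score_map_add (h : IsGaussianNoise W Z t μ) :
    score (μ.map (W + Z)) = heatScore (μ.map W) t := by
  have := h.isProbabilityMeasure_map_input
  ext1 y
  rw [score, h.density_map_add]
  exact (hasGradientAt_log_heatDensity h.pos y).gradient

lemma hasFiniteFisherInfo_add (h : IsGaussianNoise W Z t μ) : HasFiniteFisherInfo (W + Z) μ := by
  have := h.isProbabilityMeasure_map_input
  have hscore := continuous_heatScore (ν := μ.map W) h.pos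
  rw [HasFiniteFisherInfo, h.density_map_add, h.score_map_add]
  refine ⟨h.isC1Density_map_add, heatDensity_pos h.pos, ?_⟩
  rw [integrable_map_measure (by fun_prop) h.measurable_add.aemeasurable]
  exact h.memLp_heatScore_add.integrable_norm_pow two_ne_zero

lemma fisherInfo_add (h : IsGaussianNoise W Z t μ) :
    fisherInfo (W + Z) μ = heatFisherInfo (μ.map W) t := by
  have := h.isProbabilityMeasure_map_input
  have hscore := continuous_heatScore (ν := μ.map W) h.pos
  rw [fisherInfo, h.score_map_add, integral_map h.measurable_add.aemeasurable (by fun_prop),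
    h.integral_norm_heatScore_add_sq]

lemma fisherInfo_add_le (h : IsGaussianNoise W Z t μ) : fisherInfo (W + Z) μ ≤ n / t := by
  have := h.isProbabilityMeasure_map_input
  simpa only [h.fisherInfo_add, finrank_euclideanSpace_fin] using
    heatFisherInfo_le (ν := μ.map W) h.pos

lemma div_sub_fisherInfo_add (h : IsGaussianNoise W Z t μ) (hW : Integrable W μ) :
    n / t - fisherInfo (W + Z) μ = mmse W (W + Z) μ / t ^ 2 := by
  rw [h.fisherInfo_add, mmse, h.integral_norm_input_sub_condExp_sq hW,
    ← h.finrank_div_sub_heatFisherInfo, finrank_euclideanSpace_fin]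

lemma mmse_add_le_trace_covMat (h : IsGaussianNoise W Z t μ) (hW : MemLp W 2 μ) :
    mmse W (W + Z) μ ≤ (covMat W μ).trace := by
  rw [trace_covMat hW, integral_norm_sub_sq_eq_add_condExp h.measurable_add.comap_le hW
    (memLp_const _) aestronglyMeasurable_const]
  exact le_add_of_nonneg_right (integral_nonneg fun ω => by positivity)

end IsGaussianNoise

variable {Z : ℝ → Ω → EuclideanSpace ℝ (Fin n)}

lemma integrableOn_Ioi_div_sub_fisherInfo_add (h : ∀ t, 0 < t → IsGaussianNoise W (Z t) t μ)
    (hW : MemLp W 2 μ) (ht : 0 < t) :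
    IntegrableOn (fun s : ℝ => n / s - fisherInfo (W + Z s) μ) (Ioi t) := by
  have := (h t ht).isProbabilityMeasure_map_input
  refine (integrableOn_Ioi_finrank_div_sub_heatFisherInfo ((h t ht).memLp_id_map_iff.2 hW)
    ht).congr_fun (fun s hs => ?_) measurableSet_Ioi
  simp only [(h s (ht.trans hs)).fisherInfo_add, finrank_euclideanSpace_fin]

lemma toReal_mutualInfo_add_eq_integral_Ioi (h : ∀ t, 0 < t → IsGaussianNoise W (Z t) t μ)
    (hW : MemLp W 2 μ) (ht : 0 < t) :
    (mutualInfo W (W + Z t) μ).toReal =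
      1 / 2 * ∫ s in Ioi t, (n / s - fisherInfo (W + Z s) μ) := by
  have := (h t ht).isProbabilityMeasure_map_input
  rw [(h t ht).toReal_mutualInfo_add hW,
    heatEntropyGain_eq_integral_Ioi ((h t ht).memLp_id_map_iff.2 hW) ht]
  congr 1
  refine setIntegral_congr_fun measurableSet_Ioi fun s hs => ?_
  simp only [(h s (ht.trans hs)).fisherInfo_add, finrank_euclideanSpace_fin]

end Channel

theorem mainTheorem2_general {Ω α : Type*} [MeasurableSpace Ω] [MeasurableSpace α]
    (μ : Measure Ω) [IsProbabilityMeasure μ] {n : ℕ} (X : Ω → α) (hX : Measurable X)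
    (Z : ℝ → Ω → EuclideanSpace ℝ (Fin n))
    (hZ : ∀ t : ℝ, 0 < t → Measurable (Z t))
    (hZlaw : ∀ t : ℝ, 0 < t →
      μ.map (Z t) = multivariateGaussian 0 (t • (1 : Matrix (Fin n) (Fin n) ℝ)))
    (hXZ : ∀ t : ℝ, 0 < t → IndepFun X (Z t) μ)
    {f : α → EuclideanSpace ℝ (Fin n)} (hf : Measurable f) :
    (∀ t : ℝ, 0 < t →
      mutualInfo X (f ∘ X + Z t) μ = mutualInfo (f ∘ X) (f ∘ X + Z t) μ ∧
      HasFiniteFisherInfo (f ∘ X + Z t) μ ∧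
      0 ≤ n / t - fisherInfo (f ∘ X + Z t) μ) ∧
    (Integrable (f ∘ X) μ → ∀ t : ℝ, 0 < t →
      n / t - fisherInfo (f ∘ X + Z t) μ = mmse (f ∘ X) (f ∘ X + Z t) μ / t ^ 2) ∧
    (MemLp (f ∘ X) 2 μ →
      (∀ t : ℝ, 0 < t →
        mmse (f ∘ X) (f ∘ X + Z t) μ / t ^ 2 ≤ (covMat (f ∘ X) μ).trace / t ^ 2) ∧
      (∀ T : ℝ, 0 < T →
        IntegrableOn (fun t : ℝ => n / t - fisherInfo (f ∘ X + Z t) μ) (Ioi T) ∧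
        mutualInfo X (f ∘ X + Z T) μ ≠ ⊤ ∧
        (mutualInfo X (f ∘ X + Z T) μ).toReal =
          1 / 2 * ∫ t in Ioi T, (n / t - fisherInfo (f ∘ X + Z t) μ))) := by
  have hnoise : ∀ t, 0 < t → IsGaussianNoise X (Z t) t μ := fun t ht =>
    ⟨ht, hX, hZ t ht, (hZlaw t ht).trans (multivariateGaussian_zero_smul_one ht), hXZ t ht⟩
  have h : ∀ t, 0 < t → IsGaussianNoise (f ∘ X) (Z t) t μ := fun t ht => (hnoise t ht).comp hf
  have hinfo : ∀ t, 0 < t →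
      mutualInfo X (f ∘ X + Z t) μ = mutualInfo (f ∘ X) (f ∘ X + Z t) μ := fun t ht =>
    (hnoise t ht).mutualInfo_comp_add hf
  refine ⟨fun t ht => ⟨hinfo t ht, (h t ht).hasFiniteFisherInfo_add,
      sub_nonneg.2 (h t ht).fisherInfo_add_le⟩,
    fun hW t ht => (h t ht).div_sub_fisherInfo_add hW,
    fun hW => ⟨fun t ht => ?_, fun T hT => ?_⟩⟩
  · exact div_le_div_of_nonneg_right ((h t ht).mmse_add_le_trace_covMat hW) (sq_nonneg t)
  · rw [hinfo T hT]
    exact ⟨integrableOn_Ioi_div_sub_fisherInfo_add h hW hT, (h T hT).mutualInfo_add_ne_top hW,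
      toReal_mutualInfo_add_eq_integral_Ioi h hW hT⟩

theorem mainTheorem2 {Ω : Type*} [MeasurableSpace Ω] (μ : Measure Ω) [IsProbabilityMeasure μ]
    {n : ℕ} (X : Ω → EuclideanSpace ℝ (Fin n)) (hX : Measurable X)
    (Z : ℝ → Ω → EuclideanSpace ℝ (Fin n))
    (hZ : ∀ t : ℝ, 0 < t → Measurable (Z t))
    (hZlaw : ∀ t : ℝ, 0 < t →
      μ.map (Z t) = multivariateGaussian 0 (t • (1 : Matrix (Fin n) (Fin n) ℝ)))
    (hXZ : ∀ t : ℝ, 0 < t → IndepFun X (Z t) μ) :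
    -- the channel `Y_t = X + Z_t`
    (MemLp X 2 μ →
      (∀ t : ℝ, 0 < t →
        HasFiniteFisherInfo (X + Z t) μ ∧
        0 ≤ n / t - fisherInfo (X + Z t) μ ∧
        n / t - fisherInfo (X + Z t) μ = mmse X (X + Z t) μ / t ^ 2 ∧
        mmse X (X + Z t) μ / t ^ 2 ≤ (covMat X μ).trace / t ^ 2) ∧
      (∀ T : ℝ, 0 < T →
        IntegrableOn (fun t : ℝ => n / t - fisherInfo (X + Z t) μ) (Ioi T) ∧
        mutualInfo X (X + Z T) μ ≠ ⊤ ∧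
        (mutualInfo X (X + Z T) μ).toReal =
          1 / 2 * ∫ t in Ioi T, (n / t - fisherInfo (X + Z t) μ))) ∧
    -- the channel `Y_t = f(X) + Z_t`
    (∀ f : EuclideanSpace ℝ (Fin n) → EuclideanSpace ℝ (Fin n), Measurable f →
      (∀ t : ℝ, 0 < t →
        mutualInfo X (f ∘ X + Z t) μ = mutualInfo (f ∘ X) (f ∘ X + Z t) μ) ∧
      (MemLp (f ∘ X) 2 μ →
        (∀ t : ℝ, 0 < t →
          HasFiniteFisherInfo (f ∘ X + Z t) μ ∧
          0 ≤ n / t - fisherInfo (f ∘ X + Z t) μ ∧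
          n / t - fisherInfo (f ∘ X + Z t) μ = mmse (f ∘ X) (f ∘ X + Z t) μ / t ^ 2 ∧
          mmse (f ∘ X) (f ∘ X + Z t) μ / t ^ 2 ≤ (covMat (f ∘ X) μ).trace / t ^ 2) ∧
        (∀ T : ℝ, 0 < T →
          IntegrableOn (fun t : ℝ => n / t - fisherInfo (f ∘ X + Z t) μ) (Ioi T) ∧
          mutualInfo X (f ∘ X + Z T) μ ≠ ⊤ ∧
          (mutualInfo X (f ∘ X + Z T) μ).toReal =
            1 / 2 * ∫ t in Ioi T, (n / t - fisherInfo (f ∘ X + Z t) μ)))) := by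
  -- part (a) is part (b) for `f = id`
  refine (and_iff_right_of_imp fun hb => (hb id measurable_id).2).2 fun f hf => ?_
  obtain ⟨hpoint, hmmse, hL2⟩ := mainTheorem2_general μ X hX Z hZ hZlaw hXZ hf
  exact ⟨fun t ht => (hpoint t ht).1, fun hW => ⟨fun t ht => ⟨(hpoint t ht).2.1, (hpoint t ht).2.2,
    hmmse (hW.integrable one_le_two) t ht, (hL2 hW).1 t ht⟩, (hL2 hW).2⟩⟩
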